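/- Let $M$ be a smooth manifold of dimension $n$ and let $(E,\langle\cdot,\cdot\rangle,[\cdot,\cdot],\pi)$ be an odd exact Courant algebroid over $M$, i.e. a Courant algebroid (with $[\cdot,\cdot]$ the Dorfman bracket) isomorphic to $TM\oplus T^*M\oplus\mathbb{R}$ with anchor the projection to $TM$, scalar product $\langle X+\xi+\lambda,Y+\eta+\mu\rangle=\tfrac12(\eta(X)+\xi(Y))+\lambda\mu$ and Dorfman bracket $$[X+\xi+\lambda,Y+\eta+\mu]=\mathcal{L}_XY+\mathcal{L}_X\eta-i_Yd\xi+2\mu\,d\lambda+i_Xi_YH-2(\mu\, i_XF-\lambda\, i_YF)+X(\mu)-Y(\lambda)+F(X,Y)$$ for some closed $F\in\Omega^2(M)$ and some $H\in\Omega^3(M)$ with $dH=-F\wedge F$. A generalized metric on $E$ is a rank $n$ subbundle $E_-\subset E$ on which $\langle\cdot,\cdot\rangle$ is non-degenerate and on which $\pi$ restricts to an isomorphism $E_-\to TM$; put $E_+=E_-^\perp$, and let $\mathcal{G}^{\mathrm{end}}\in\Gamma(\mathrm{End}\,E)$ be $\pm\mathrm{Id}$ on $E_\pm$. A $B_n$-generalized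 almost complex structure is an isotropic complex rank $n$ subbundle $L\subset E_{\mathbb{C}}$ with $L\cap\bar L=0$, equivalently the endomorphism $\mathcal{F}\in\Gamma(\mathrm{End}\,E)$ which is $i$ on $L$, $-i$ on $\bar L$ and $0$ on $(L\oplus\bar L)^\perp$. A subbundle of $E_{\mathbb C}$ is called integrable if its space of sections is closed under the (complex bilinearly extended) Dorfman bracket, and $\mathcal{F}$ is called a $B_n$-generalized complex structure if its $i$-eigenbundle $L$ is integrable. Let $(\mathcal{G},\mathcal{F})$ be a $B_n$-generalized almost pseudo-Hermitian structure on $E$, i.e. a generalized metric together with a $B_n$-generalized almost complex structure such that $\mathcal{G}^{\mathrm{end}}\mathcal{F}=\mathcal{F}\mathcal{G}^{\mathrm{end}}$. It is called integrable if $\mathcal{F}$ and $\mathcal{F}_2:=\mathcal{G}^{\mathrm{end}}\mathcal{F}$ are both $B_n$-generalized complex structures. Let $L_1,L_2\subset E_{\mathbb{C}}$ be the $i$-eigenbundles of $\mathcal{F},\mathcal{F}_2$, let $L_1^+=L_1\cap L_2$ and $L_1^-=L_1\cap\bar L_2$, and let $u_0\in\Gamma(\mathrm{Ker}\,\mathcal{F})$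 satisfy $\langle u_0,u_0\rangle=(-1)^n$. Write $\mathbf{L}_{u_0}v=[u_0,v]$, extended complex linearly to $\Gamma(E_{\mathbb C})$. Then: 1. If $L_1$ is integrable, then $\mathbf{L}_{u_0}$ preserves $\Gamma(L_1^+)$ if and only if it preserves $\Gamma(L_1^-)$. 2. $(\mathcal{G},\mathcal{F})$ is integrable if and only if $L_1$, $L_1^+$ and $L_1^-$ are integrable and $\mathbf{L}_{u_0}$ preserves $\Gamma(L_1^+)$. 3. $(\mathcal{G},\mathcal{F})$ is integrable if and only if $L_1$, $L_1^+$ and $L_1^-$ are integrable and $\mathbf{L}_{u_0}$ preserves $\Gamma(L_1^-)$. -/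

import Mathlib

open Bundle VectorField
open scoped Manifold Topology ContDiff TensorProduct

noncomputable section

namespace BnGeometry

/-! ## Sections, vector fields and differential forms

`M` is a smooth manifold of dimension `n` and `E` is a smooth real vector bundle over `M`
with model fibre `R`. -/

/-- The space `Γ(E)` of smooth sections of the vector bundle `E`. -/
abbrev Sec (n : ℕ) {M : Type*} [TopologicalSpace M] [ChartedSpace (EuclideanSpace ℝ (Fin n)) M]
    (R : Type*) [NormedAddCommGroup R] [NormedSpace ℝ R]
    (E : M → Type*) [TopologicalSpace (TotalSpace R E)] [∀ x, TopologicalSpace (E x)]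
    [FiberBundle R E] : Type _ :=
  ContMDiffSection (𝓡 n) R ∞ E

/-- The space `𝔛(M)` of smooth vector fields. -/
abbrev VField (n : ℕ) (M : Type*) [TopologicalSpace M]
    [ChartedSpace (EuclideanSpace ℝ (Fin n)) M] [IsManifold (𝓡 n) ∞ M] : Type _ :=
  Sec n (EuclideanSpace ℝ (Fin n)) (fun x : M => TangentSpace (𝓡 n) x)

section Forms

variable {n : ℕ} {M : Type*} [TopologicalSpace M] [ChartedSpace (EuclideanSpace ℝ (Fin n)) M]

/-- Smoothness of a real function on `M`. -/
def SmoothFun (n : ℕ) {M : Type*} [TopologicalSpace M]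
    [ChartedSpace (EuclideanSpace ℝ (Fin n)) M] (f : M → ℝ) : Prop :=
  ContMDiff (𝓡 n) 𝓘(ℝ, ℝ) ∞ f

/-- The derivative `X(f)` at `x` of the function `f` in the direction of the tangent vector `X`. -/
def dirDeriv (f : M → ℝ) (x : M) (X : TangentSpace (𝓡 n) x) : ℝ :=
  mvfderiv (𝓡 n) f x X

/-- A smooth differential `k`-form on `M`: a field of alternating `k`-linear forms on the tangent
spaces which is smooth, i.e. whose value on any `k` smooth vector fields is a smooth function. -/
structure DiffForm (n : ℕ) (M : Type*) [TopologicalSpace M]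
    [ChartedSpace (EuclideanSpace ℝ (Fin n)) M] [IsManifold (𝓡 n) ∞ M] (k : ℕ) where
  /-- the value at a point -/
  val : ∀ x : M, (TangentSpace (𝓡 n) x) [⋀^Fin k]→ₗ[ℝ] ℝ
  smooth : ∀ X : Fin k → VField n M, SmoothFun n (fun x => val x (fun i => X i x))

variable [IsManifold (𝓡 n) ∞ M]

/-- `(dα)(X, Y, Z)` for a 2-form `α`, by the invariant formula for the exterior derivative. -/
def extDerivTwo (α : DiffForm n M 2) (X Y Z : VField n M) (x : M) : ℝ :=
  dirDeriv (fun y => α.val y ![Y y, Z y]) x (X x)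
    - dirDeriv (fun y => α.val y ![X y, Z y]) x (Y x)
    + dirDeriv (fun y => α.val y ![X y, Y y]) x (Z x)
    - α.val x ![mlieBracket (𝓡 n) X Y x, Z x]
    + α.val x ![mlieBracket (𝓡 n) X Z x, Y x]
    - α.val x ![mlieBracket (𝓡 n) Y Z x, X x]

/-- `(dα)(X, Y, Z, W)` for a 3-form `α`, by the invariant formula for the exterior derivative. -/
def extDerivThree (α : DiffForm n M 3) (X Y Z W : VField n M) (x : M) : ℝ :=
  dirDeriv (fun y => α.val y ![Y y, Z y, W y]) x (X x)
    - dirDeriv (fun y => α.val y ![X y, Z y, W y]) x (Y x)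
    + dirDeriv (fun y => α.val y ![X y, Y y, W y]) x (Z x)
    - dirDeriv (fun y => α.val y ![X y, Y y, Z y]) x (W x)
    - α.val x ![mlieBracket (𝓡 n) X Y x, Z x, W x]
    + α.val x ![mlieBracket (𝓡 n) X Z x, Y x, W x]
    - α.val x ![mlieBracket (𝓡 n) X W x, Y x, Z x]
    - α.val x ![mlieBracket (𝓡 n) Y Z x, X x, W x]
    + α.val x ![mlieBracket (𝓡 n) Y W x, X x, Z x]
    - α.val x ![mlieBracket (𝓡 n) Z W x, X x, Y x]

/-- `(α ∧ α)(X, Y, Z, W)` for a 2-form `α` (sum over the six `(2,2)`-shuffles). -/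
def wedgeSq (α : DiffForm n M 2) (X Y Z W : VField n M) (x : M) : ℝ :=
  2 * (α.val x ![X x, Y x] * α.val x ![Z x, W x]
    - α.val x ![X x, Z x] * α.val x ![Y x, W x]
    + α.val x ![X x, W x] * α.val x ![Y x, Z x])

end Forms

/-! ## The bundle `TM ⊕ T*M ⊕ ℝ` with its twisted Dorfman bracket -/

section TypeB

variable {n : ℕ} {M : Type*} [TopologicalSpace M] [ChartedSpace (EuclideanSpace ℝ (Fin n)) M]

/-- The fibre `T_xM ⊕ T_x^*M ⊕ ℝ`; its elements are triples `(X, ξ, λ)`. -/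
abbrev BFibre (n : ℕ) {M : Type*} [TopologicalSpace M]
    [ChartedSpace (EuclideanSpace ℝ (Fin n)) M] (x : M) : Type :=
  TangentSpace (𝓡 n) x × Module.Dual ℝ (TangentSpace (𝓡 n) x) × ℝ

/-- The scalar product `⟨X + ξ + λ, Y + η + μ⟩ = (η(X) + ξ(Y)) / 2 + λ μ`. -/
def bScalar {x : M} (u v : BFibre n x) : ℝ :=
  (1 / 2) * (v.2.1 u.1 + u.2.1 v.1) + u.2.2 * v.2.2

variable [IsManifold (𝓡 n) ∞ M]

/-- Smoothness of a section `(X, ξ, λ)` of `TM ⊕ T*M ⊕ ℝ`: the vector field `X`, the 1-form `ξ`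
and the function `λ` are smooth. -/
def BSmooth (s : ∀ x : M, BFibre n x) : Prop :=
  ContMDiff (𝓡 n) ((𝓡 n).prod 𝓘(ℝ, EuclideanSpace ℝ (Fin n))) ∞
      (fun x => TotalSpace.mk' (EuclideanSpace ℝ (Fin n)) x (s x).1)
    ∧ (∀ Z : VField n M, SmoothFun n (fun x => (s x).2.1 (Z x)))
    ∧ SmoothFun n (fun x => (s x).2.2)

/-- `w = [u, v]` for the Dorfman bracket twisted by `(H, F)` on `TM ⊕ T*M ⊕ ℝ`: with
`u = X + ξ + λ` and `v = Y + η + μ`,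
`[u, v] = 𝓛_X Y + 𝓛_X η - i_Y dξ + 2 μ dλ + i_X i_Y H - 2 (μ i_X F - λ i_Y F)
  + X(μ) - Y(λ) + F(X, Y)`.
The equality of 1-forms is expressed by evaluation on all vector fields `Z`, where
`(𝓛_X η)(Z) = X(η(Z)) - η([X, Z])`, `dξ(Y, Z) = Y(ξ(Z)) - Z(ξ(Y)) - ξ([Y, Z])` and
`(i_X i_Y H)(Z) = H(Y, X, Z)`. -/
def IsTwistedDorfman (H : DiffForm n M 3) (F : DiffForm n M 2)
    (u v w : ∀ x : M, BFibre n x) : Prop :=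
  let X := fun x => (u x).1
  let ξ := fun x => (u x).2.1
  let l := fun x => (u x).2.2
  let Y := fun x => (v x).1
  let η := fun x => (v x).2.1
  let m := fun x => (v x).2.2
  ∀ x : M,
    (w x).1 = mlieBracket (𝓡 n) X Y x
    ∧ (∀ Z : VField n M,
        (w x).2.1 (Z x) =
          (dirDeriv (fun y => η y (Z y)) x (X x) - η x (mlieBracket (𝓡 n) X Z x))
          - (dirDeriv (fun y => ξ y (Z y)) x (Y x) - dirDeriv (fun y => ξ y (Y y)) x (Z x)
              - ξ x (mlieBracket (𝓡 n) Y Z x))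
          + 2 * m x * dirDeriv l x (Z x)
          + H.val x ![Y x, X x, Z x]
          - 2 * (m x * F.val x ![X x, Z x] - l x * F.val x ![Y x, Z x]))
    ∧ (w x).2.2 = dirDeriv m x (X x) - dirDeriv l x (Y x) + F.val x ![X x, Y x]

end TypeB

/-! ## Complexification -/

section Complexification

/-- The complexification `V ⊗ ℂ` of a real vector space. -/
abbrev Cx (V : Type*) [AddCommGroup V] [Module ℝ V] : Type _ := ℂ ⊗[ℝ] V

variable {V : Type*} [AddCommGroup V] [Module ℝ V]

/-- The vector `a + i b` of the complexification. -/
def cxMk (a b : V) : Cx V := (1 : ℂ) ⊗ₜ[ℝ] a + Complex.I ⊗ₜ[ℝ] b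

/-- Complex conjugation on the complexification. -/
def cxConj : Cx V →ₗ[ℝ] Cx V :=
  LinearMap.rTensor V Complex.conjAe.toLinearMap

theorem cxConj_smul (c : ℂ) (v : Cx V) : cxConj (c • v) = (starRingEnd ℂ c) • cxConj v := by
  induction v using TensorProduct.induction_on with
  | zero => simp
  | tmul a b => simp [cxConj, TensorProduct.smul_tmul']
  | add a b ha hb => rw [smul_add, map_add, ha, hb, map_add, smul_add]

theorem cxConj_cxConj (v : Cx V) : cxConj (cxConj v) = v := by
  induction v using TensorProduct.induction_on with
  | zero => simp
  | tmul a b => simp [cxConj]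
  | add a b ha hb => rw [map_add, map_add, ha, hb]

/-- The complex conjugate `S̄ = {v̄ | v ∈ S}` of a complex subspace (as conjugation is an
involution, `v ∈ S̄` iff `v̄ ∈ S`). -/
def conjSub (S : Submodule ℂ (Cx V)) : Submodule ℂ (Cx V) where
  carrier := {v | cxConj v ∈ S}
  add_mem' := fun {a b} ha hb => by
    simp only [Set.mem_ofPred_eq, map_add] at *
    exact S.add_mem ha hb
  zero_mem' := by simp
  smul_mem' := fun c v hv => by
    simp only [Set.mem_ofPred_eq, cxConj_smul] at *
    exact S.smul_mem _ hv

/-- The `i`-eigenspace, in the complexification, of a real endomorphism. -/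
def eigI (A : Module.End ℝ V) : Submodule ℂ (Cx V) :=
  Module.End.eigenspace (LinearMap.baseChange ℂ A : Module.End ℂ (Cx V)) Complex.I

end Complexification

section Bundles

variable {n : ℕ} {M : Type*} [TopologicalSpace M] [ChartedSpace (EuclideanSpace ℝ (Fin n)) M]
  {R : Type*} [NormedAddCommGroup R] [NormedSpace ℝ R]
  {E : M → Type*} [TopologicalSpace (TotalSpace R E)] [∀ x, TopologicalSpace (E x)]
  [∀ x, AddCommGroup (E x)] [∀ x, Module ℝ (E x)] [FiberBundle R E]

/-- Smoothness of a (not necessarily continuous) section of `E`. -/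
def SmoothSection (n : ℕ) {M : Type*} [TopologicalSpace M]
    [ChartedSpace (EuclideanSpace ℝ (Fin n)) M] (R : Type*) [NormedAddCommGroup R]
    [NormedSpace ℝ R] {E : M → Type*} [TopologicalSpace (TotalSpace R E)]
    [∀ x, TopologicalSpace (E x)] [FiberBundle R E] (s : ∀ x, E x) : Prop :=
  ContMDiff (𝓡 n) ((𝓡 n).prod 𝓘(ℝ, R)) ∞ (fun x => TotalSpace.mk' R x (s x))

/-- The space `Γ(E_ℂ)` of smooth sections of the complexified bundle; the pair `(a, b)` of smooth
sections of `E` represents `a + i b`. -/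
abbrev CSec (n : ℕ) {M : Type*} [TopologicalSpace M]
    [ChartedSpace (EuclideanSpace ℝ (Fin n)) M] (R : Type*) [NormedAddCommGroup R]
    [NormedSpace ℝ R] (E : M → Type*) [TopologicalSpace (TotalSpace R E)]
    [∀ x, TopologicalSpace (E x)] [FiberBundle R E] : Type _ :=
  Sec n R E × Sec n R E

/-- The value at `x` of a section of `E_ℂ`. -/
def CSec.eval (s : CSec n R E) (x : M) : Cx (E x) := cxMk (s.1 x) (s.2 x)

/-- `s ∈ Γ(S)`, where `S` is a family of subspaces of the fibres of `E_ℂ`. -/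
def IsSectionOf (S : ∀ x, Submodule ℂ (Cx (E x))) (s : CSec n R E) : Prop :=
  ∀ x, CSec.eval s x ∈ S x

/-- `S` is a smooth subbundle of rank `k` of the real bundle `E`: near each point there is a frame
of `S` formed by `k` smooth sections. (By a cut-off, one may take the sections of `E` to be
globally defined; they are required to span `S` only near the point.) -/
def IsSubbundle (n : ℕ) {M : Type*} [TopologicalSpace M]
    [ChartedSpace (EuclideanSpace ℝ (Fin n)) M] (R : Type*) [NormedAddCommGroup R]
    [NormedSpace ℝ R] {E : M → Type*} [TopologicalSpace (TotalSpace R E)]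
    [∀ x, TopologicalSpace (E x)] [∀ x, AddCommGroup (E x)] [∀ x, Module ℝ (E x)]
    [FiberBundle R E] (k : ℕ) (S : ∀ x, Submodule ℝ (E x)) : Prop :=
  ∀ x₀ : M, ∃ s : Fin k → Sec n R E, ∀ᶠ x in 𝓝 x₀,
    LinearIndependent ℝ (fun i => s i x) ∧ Submodule.span ℝ (Set.range fun i => s i x) = S x

/-- `S` is a smooth complex subbundle of rank `k` of the complexified bundle `E_ℂ`. -/
def IsCxSubbundle (n : ℕ) {M : Type*} [TopologicalSpace M]
    [ChartedSpace (EuclideanSpace ℝ (Fin n)) M] (R : Type*) [NormedAddCommGroup R]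
    [NormedSpace ℝ R] {E : M → Type*} [TopologicalSpace (TotalSpace R E)]
    [∀ x, TopologicalSpace (E x)] [∀ x, AddCommGroup (E x)] [∀ x, Module ℝ (E x)]
    [FiberBundle R E] (k : ℕ) (S : ∀ x, Submodule ℂ (Cx (E x))) : Prop :=
  ∀ x₀ : M, ∃ s : Fin k → CSec n R E, ∀ᶠ x in 𝓝 x₀,
    LinearIndependent ℂ (fun i => CSec.eval (s i) x)
      ∧ Submodule.span ℂ (Set.range fun i => CSec.eval (s i) x) = S x

end Bundles

/-! ## Courant algebroids -/

/-- A Courant algebroid structure on the smooth vector bundle `E` over `M`. -/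
structure CourantAlgebroid (n : ℕ) {M : Type*} [TopologicalSpace M]
    [ChartedSpace (EuclideanSpace ℝ (Fin n)) M] [IsManifold (𝓡 n) ∞ M]
    (R : Type*) [NormedAddCommGroup R] [NormedSpace ℝ R]
    (E : M → Type*) [TopologicalSpace (TotalSpace R E)] [∀ x, TopologicalSpace (E x)]
    [∀ x, AddCommGroup (E x)] [∀ x, Module ℝ (E x)] [FiberBundle R E] [VectorBundle ℝ R E]
    [ContMDiffVectorBundle ∞ R E (𝓡 n)] where
  /-- the scalar product -/
  form : ∀ x, LinearMap.BilinForm ℝ (E x)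
  form_symm : ∀ x, (form x).IsSymm
  form_nondeg : ∀ x, (form x).Nondegenerate
  form_smooth : ∀ u v : Sec n R E, SmoothFun n (fun x => form x (u x) (v x))
  /-- the Dorfman bracket on smooth sections -/
  bracket : Sec n R E →ₗ[ℝ] Sec n R E →ₗ[ℝ] Sec n R E
  /-- the anchor, a homomorphism of vector bundles `E → TM` -/
  anchor : ∀ x, E x →ₗ[ℝ] TangentSpace (𝓡 n) x
  anchor_smooth : ∀ u : Sec n R E,
    SmoothSection n (EuclideanSpace ℝ (Fin n)) (fun x => anchor x (u x))
  jacobi : ∀ u v w : Sec n R E,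
    bracket u (bracket v w) = bracket (bracket u v) w + bracket v (bracket u w)
  anchor_bracket : ∀ (u v : Sec n R E) (x : M),
    anchor x (bracket u v x)
      = mlieBracket (𝓡 n) (fun y => anchor y (u y)) (fun y => anchor y (v y)) x
  leibniz : ∀ (u v w : Sec n R E) (f : M → ℝ), SmoothFun n f → (∀ x, w x = f x • v x) →
    ∀ x, bracket u w x = dirDeriv f x (anchor x (u x)) • v x + f x • bracket u v x
  metric_compat : ∀ (u v w : Sec n R E) (x : M),
    dirDeriv (fun y => form y (v y) (w y)) x (anchor x (u x))
      = form x (bracket u v x) (w x) + form x (v x) (bracket u w x)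
  bracket_self : ∀ (u v : Sec n R E) (x : M),
    2 * form x (bracket u u x) (v x)
      = dirDeriv (fun y => form y (u y) (u y)) x (anchor x (v x))

namespace CourantAlgebroid

variable {n : ℕ} {M : Type*} [TopologicalSpace M] [ChartedSpace (EuclideanSpace ℝ (Fin n)) M]
  [IsManifold (𝓡 n) ∞ M]
  {R : Type*} [NormedAddCommGroup R] [NormedSpace ℝ R]
  {E : M → Type*} [TopologicalSpace (TotalSpace R E)] [∀ x, TopologicalSpace (E x)]
  [∀ x, AddCommGroup (E x)] [∀ x, Module ℝ (E x)] [FiberBundle R E] [VectorBundle ℝ R E]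
  [ContMDiffVectorBundle ∞ R E (𝓡 n)]

/-- `C` is an odd exact Courant algebroid: it is isomorphic to the Courant algebroid of type `B_n`
`E_{H,F} = TM ⊕ T*M ⊕ ℝ` for some closed 2-form `F` and some 3-form `H` with `dH = - F ∧ F`.
The isomorphism `Φ` is a smooth isomorphism of vector bundles over the identity of `M`,
compatible with the scalar products, the anchors and the Dorfman brackets. -/
def IsOddExact (C : CourantAlgebroid n R E) : Prop :=
  ∃ (H : DiffForm n M 3) (F : DiffForm n M 2) (Φ : ∀ x, E x ≃ₗ[ℝ] BFibre n x),
    (∀ X Y Z x, extDerivTwo F X Y Z x = 0)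
    ∧ (∀ X Y Z W x, extDerivThree H X Y Z W x = - wedgeSq F X Y Z W x)
    ∧ (∀ s : ∀ x, E x, SmoothSection n R s ↔ BSmooth (fun x => Φ x (s x)))
    ∧ (∀ x (u v : E x), bScalar (Φ x u) (Φ x v) = C.form x u v)
    ∧ (∀ x (u : E x), (Φ x u).1 = C.anchor x u)
    ∧ (∀ u v : Sec n R E, IsTwistedDorfman H F (fun x => Φ x (u x)) (fun x => Φ x (v x))
        (fun x => Φ x (C.bracket u v x)))

/-- The complex bilinear extension of the scalar product. -/
def formC (C : CourantAlgebroid n R E) (x : M) : LinearMap.BilinForm ℂ (Cx (E x)) :=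
  LinearMap.BilinForm.baseChange ℂ (C.form x)

/-- The complex bilinear extension of the Dorfman bracket,
`[a + i b, c + i d] = ([a, c] - [b, d]) + i ([a, d] + [b, c])`. -/
def bracketC (C : CourantAlgebroid n R E) (u v : CSec n R E) : CSec n R E :=
  (C.bracket u.1 v.1 - C.bracket u.2 v.2, C.bracket u.1 v.2 + C.bracket u.2 v.1)

/-- Dorfman integrability of a subbundle of `E_ℂ`: its sections are closed under the bracket. -/
def IntegrableSub (C : CourantAlgebroid n R E) (S : ∀ x, Submodule ℂ (Cx (E x))) : Prop :=
  ∀ u v : CSec n R E, IsSectionOf S u → IsSectionOf S v → IsSectionOf S (C.bracketC u v)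

/-- The Dorfman Lie derivative `𝐋_u = [u, ·]`, extended complex linearly to `Γ(E_ℂ)`, preserves
the space of sections `Γ(S)`. -/
def LiePreserves (C : CourantAlgebroid n R E) (u : Sec n R E)
    (S : ∀ x, Submodule ℂ (Cx (E x))) : Prop :=
  ∀ v : CSec n R E, IsSectionOf S v → IsSectionOf S (C.bracket u v.1, C.bracket u v.2)

/-- A generalized metric (always assumed admissible): a subbundle `E₋ ⊆ E` of rank `n = dim M` on
which the scalar product is non-degenerate and on which the anchor is an isomorphism to `TM`. -/
structure GenMetric (C : CourantAlgebroid n R E) where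
  /-- the bundle `E₋` -/
  minus : ∀ x, Submodule ℝ (E x)
  subbundle : IsSubbundle n R n minus
  nondeg : ∀ x, ((C.form x).restrict (minus x)).Nondegenerate
  admissible : ∀ x, Function.Bijective ((C.anchor x).domRestrict (minus x))

/-- The bundle `E₊`, the orthogonal complement of `E₋`. -/
def GenMetric.plus {C : CourantAlgebroid n R E} (G : C.GenMetric) (x : M) : Submodule ℝ (E x) :=
  (C.form x).orthogonal (G.minus x)

theorem GenMetric.isCompl [FiniteDimensional ℝ R] {C : CourantAlgebroid n R E}
    (G : C.GenMetric) (x : M) : IsCompl (G.plus x) (G.minus x) := by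
  have : FiniteDimensional ℝ (E x) := VectorBundle.finiteDimensional ℝ R E x
  exact (LinearMap.BilinForm.isCompl_orthogonal_of_restrict_nondegenerate
    (C.form_symm x).isRefl (G.nondeg x)).symm

/-- The endomorphism `𝒢^end` which is `Id` on `E₊` and `-Id` on `E₋`. -/
def GenMetric.gend [FiniteDimensional ℝ R] {C : CourantAlgebroid n R E} (G : C.GenMetric)
    (x : M) : Module.End ℝ (E x) :=
  (G.plus x).projection (G.minus x) (G.isCompl x)
    - (G.minus x).projection (G.plus x) (G.isCompl x).symm

/-- The field of endomorphisms `A` is a `B_n`-generalized almost complex structure: it is a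
smooth section of `End E` whose `i`-eigenbundle `L ⊆ E_ℂ` is an isotropic subbundle of rank
`n = dim M` with `L ∩ L̄ = 0`, and it vanishes on the orthogonal complement of `L ⊕ L̄`.
(So `A` is the endomorphism which is `i` on `L`, `-i` on `L̄` and `0` on the orthogonal
complement of `L ⊕ L̄`, and it is determined by `L`.) -/
structure IsAlmostComplex (C : CourantAlgebroid n R E) (A : ∀ x, Module.End ℝ (E x)) : Prop where
  smooth : ∀ s : Sec n R E, SmoothSection n R (fun x => A x (s x))
  subbundle : IsCxSubbundle n R n (fun x => eigI (A x))
  isotropic : ∀ x, ∀ v ∈ eigI (A x), ∀ w ∈ eigI (A x), C.formC x v w = 0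
  disjoint : ∀ x, eigI (A x) ⊓ conjSub (eigI (A x)) = ⊥
  kernel : ∀ x (w : Cx (E x)), (∀ v ∈ eigI (A x) ⊔ conjSub (eigI (A x)), C.formC x w v = 0) →
    LinearMap.baseChange ℂ (A x) w = 0

/-- A `B_n`-generalized complex structure: a `B_n`-generalized almost complex structure whose
`i`-eigenbundle is Dorfman integrable. -/
def IsComplex (C : CourantAlgebroid n R E) (A : ∀ x, Module.End ℝ (E x)) : Prop :=
  C.IsAlmostComplex A ∧ C.IntegrableSub (fun x => eigI (A x))

/-- A `B_n`-generalized almost pseudo-Hermitian structure `(𝒢, 𝓕)`. -/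
structure AlmostPseudoHermitian [FiniteDimensional ℝ R] (C : CourantAlgebroid n R E) where
  /-- the generalized metric -/
  metric : C.GenMetric
  /-- the `B_n`-generalized almost complex structure -/
  F : ∀ x, Module.End ℝ (E x)
  almostComplex : C.IsAlmostComplex F
  comm : ∀ x, metric.gend x * F x = F x * metric.gend x

namespace AlmostPseudoHermitian

variable [FiniteDimensional ℝ R] {C : CourantAlgebroid n R E}

/-- The endomorphism `𝓕₂ = 𝒢^end 𝓕`. -/
def F₂ (P : C.AlmostPseudoHermitian) (x : M) : Module.End ℝ (E x) := P.metric.gend x * P.F x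

/-- Integrability of `(𝒢, 𝓕)` (i.e. `(𝒢, 𝓕)` is a `B_n`-generalized pseudo-Kähler structure):
both `𝓕` and `𝓕₂ = 𝒢^end 𝓕` are `B_n`-generalized complex structures. -/
def IsIntegrable (P : C.AlmostPseudoHermitian) : Prop := C.IsComplex P.F ∧ C.IsComplex P.F₂

/-- `L₁`, the `i`-eigenbundle of `𝓕`. -/
def L₁ (P : C.AlmostPseudoHermitian) (x : M) : Submodule ℂ (Cx (E x)) := eigI (P.F x)

/-- `L₂`, the `i`-eigenbundle of `𝓕₂`. -/
def L₂ (P : C.AlmostPseudoHermitian) (x : M) : Submodule ℂ (Cx (E x)) := eigI (P.F₂ x)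

/-- `L₁⁺ = L₁ ∩ L₂`. -/
def L₁plus (P : C.AlmostPseudoHermitian) (x : M) : Submodule ℂ (Cx (E x)) := P.L₁ x ⊓ P.L₂ x

/-- `L₁⁻ = L₁ ∩ L̄₂`. -/
def L₁minus (P : C.AlmostPseudoHermitian) (x : M) : Submodule ℂ (Cx (E x)) :=
  P.L₁ x ⊓ conjSub (P.L₂ x)

/-- `u₀` is a smooth section of `Ker 𝓕` with `⟨u₀, u₀⟩ = (-1)^n`. -/
def IsNormalizedKernelSection (P : C.AlmostPseudoHermitian) (u₀ : Sec n R E) : Prop :=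
  ∀ x, P.F x (u₀ x) = 0 ∧ C.form x (u₀ x) (u₀ x) = (-1) ^ n

end AlmostPseudoHermitian

end CourantAlgebroid

end BnGeometry

end

/-! Since E has rank 2n+1 and L₁ is isotropic of rank n with L₁ ∩ L̄₁ = 0, the endomorphism 𝓕 is
skew-adjoint with 𝓕³ = -𝓕 and its kernel is the line of u₀. As 𝒢^end is a self-adjoint involution
commuting with 𝓕, the same holds for 𝓕₂. Both are therefore instances of one structure
(`IsSkewCube`, `IsSkewCubeField`), which is stable under A ↦ -A, that is, under complex conjugation
of the i-eigenbundle.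

For such A with i-eigenbundle L, one has L^⊥ = L ⊕ ℂu₀, so membership in L is tested by pairing with
L and with u₀ (`IsSkewCubeField.isSectionOf`). The Courant axioms lose their derivative terms on
orthogonal sections: ⟨[u,v],w⟩ changes sign under exchange of u and v if ⟨u,v⟩ = 0, and of v and w
if ⟨v,w⟩ = 0 (`formC_bracketC_swap`, `formC_bracketC`). All integrability statements follow by
moving arguments in this way.

If L is integrable, 𝐋_{u₀} preserves it: ⟨[u₀,v],w⟩ = ⟨u₀,[v,w]⟩ = 0 for v, w in L, and ⟨[u₀,v],u₀⟩
= 0 since ⟨u₀,u₀⟩ is constant (`liePreserves`). The relation 𝓕² = 𝓕₂² gives L̄₂ = L₁⁻ ⊕ (conjugate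
of L₁⁺), and 𝐋_{u₀} is skew for the pairing of L₁⁻ with the latter summand, whence the equivalence
in part 1 (`liePreserves_inf_neg`). Likewise L₂ = L₁⁺ ⊕ (conjugate of L₁⁻). Integrability of the
summands controls the pairings of a mixed bracket with L₂, while its component along u₀ is
controlled exactly by 𝐋_{u₀} (`integrableSub_of_inf`). It must also be shown that 𝓕₂ is smooth with
a smooth eigenbundle (`smoothSection_gend`, `isCxSubbundle`). -/

noncomputable section

namespace BnGeometry

set_option linter.unusedSectionVars false

/-! ### Linear algebra in the complexification of one fibre. -/

section ComplexifiedLinearAlgebra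

variable {V : Type*} [AddCommGroup V] [Module ℝ V]

/-- The real part of a vector of the complexification. -/
def cxRe : Cx V →ₗ[ℝ] V :=
  (TensorProduct.lid ℝ V).toLinearMap ∘ₗ LinearMap.rTensor V Complex.reLm

/-- The imaginary part of a vector of the complexification. -/
def cxIm : Cx V →ₗ[ℝ] V :=
  (TensorProduct.lid ℝ V).toLinearMap ∘ₗ LinearMap.rTensor V Complex.imLm

@[simp] theorem cxRe_cxMk (a b : V) : cxRe (cxMk a b) = a := by
  simp [cxRe, cxMk]

@[simp] theorem cxIm_cxMk (a b : V) : cxIm (cxMk a b) = b := by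
  simp [cxIm, cxMk]

theorem cxMk_inj {a b c d : V} : cxMk a b = cxMk c d ↔ a = c ∧ b = d := by
  refine ⟨fun h => ⟨?_, ?_⟩, by rintro ⟨rfl, rfl⟩; rfl⟩
  · simpa using congrArg cxRe h
  · simpa using congrArg cxIm h

@[simp] theorem cxMk_zero : cxMk (0 : V) 0 = 0 := by simp [cxMk]

theorem cxMk_add (a b c d : V) : cxMk a b + cxMk c d = cxMk (a + c) (b + d) := by
  simp only [cxMk, TensorProduct.tmul_add]; abel

theorem cxMk_neg (a b : V) : -cxMk a b = cxMk (-a) (-b) := by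
  simp only [cxMk, TensorProduct.tmul_neg]; abel

theorem smul_cxMk (c : ℂ) (a b : V) :
    c • cxMk a b = cxMk (c.re • a - c.im • b) (c.re • b + c.im • a) := by
  have h : ∀ (r : ℝ) (z : ℂ) (v : V), z ⊗ₜ[ℝ] (r • v) = ((r : ℂ) * z) ⊗ₜ[ℝ] v := fun r z v => by
    rw [← TensorProduct.smul_tmul, Complex.real_smul]
  simp only [cxMk, smul_add, TensorProduct.smul_tmul', smul_eq_mul, TensorProduct.tmul_add,
    TensorProduct.tmul_sub, h]
  have h1 : ((c.re : ℂ) * 1) ⊗ₜ[ℝ] a + ((c.im : ℂ) * Complex.I) ⊗ₜ[ℝ] a = (c * 1) ⊗ₜ[ℝ] a := by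
    rw [← TensorProduct.add_tmul, mul_one, mul_one, Complex.re_add_im]
  have h2 : ((c.re : ℂ) * Complex.I) ⊗ₜ[ℝ] b - ((c.im : ℂ) * 1) ⊗ₜ[ℝ] b
      = (c * Complex.I) ⊗ₜ[ℝ] b := by
    rw [← TensorProduct.sub_tmul]
    congr 1
    apply Complex.ext <;> simp
  rw [← h1, ← h2]; abel

theorem I_smul_cxMk (a b : V) : Complex.I • cxMk a b = cxMk (-b) a := by
  simp [smul_cxMk]

theorem exists_eq_cxMk (z : Cx V) : ∃ a b, z = cxMk a b := by
  induction z using TensorProduct.induction_on with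
  | zero => exact ⟨0, 0, by simp⟩
  | tmul c v =>
    refine ⟨c.re • v, c.im • v, ?_⟩
    have := smul_cxMk c v 0
    simpa [cxMk, TensorProduct.smul_tmul'] using this
  | add x y hx hy =>
    obtain ⟨a, b, rfl⟩ := hx
    obtain ⟨c, d, rfl⟩ := hy
    exact ⟨_, _, cxMk_add a b c d⟩

@[simp] theorem cxConj_cxMk (a b : V) : cxConj (cxMk a b) = cxMk a (-b) := by
  simp [cxConj, cxMk, TensorProduct.tmul_neg, TensorProduct.neg_tmul]

theorem baseChange_cxMk (A : Module.End ℝ V) (a b : V) :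
    LinearMap.baseChange ℂ A (cxMk a b) = cxMk (A a) (A b) := by
  simp [cxMk]

theorem formBaseChange_cxMk (B : LinearMap.BilinForm ℝ V) (a b c d : V) :
    LinearMap.BilinForm.baseChange ℂ B (cxMk a b) (cxMk c d)
      = ⟨B a c - B b d, B a d + B b c⟩ := by
  apply Complex.ext <;>
    simp [cxMk, LinearMap.BilinForm.baseChange_tmul, sub_eq_add_neg]

theorem cxMk_mem_eigI {A : Module.End ℝ V} {a b : V} :
    cxMk a b ∈ eigI A ↔ A a = -b ∧ A b = a := by
  rw [eigI, Module.End.mem_eigenspace_iff, baseChange_cxMk, I_smul_cxMk, cxMk_inj]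

theorem cxMk_mem_conjSub {S : Submodule ℂ (Cx V)} {a b : V} :
    cxMk a b ∈ conjSub S ↔ cxMk a (-b) ∈ S := by
  change cxConj (cxMk a b) ∈ S ↔ _
  rw [cxConj_cxMk]

/-- A real endomorphism commutes with conjugation, which sends the eigenvalue i to -i. This lets
every statement about L be applied to L̄ by replacing A with -A. -/
theorem conjSub_eigI (A : Module.End ℝ V) : conjSub (eigI A) = eigI (-A) := by
  ext z
  obtain ⟨a, b, rfl⟩ := exists_eq_cxMk z
  rw [cxMk_mem_conjSub, cxMk_mem_eigI, cxMk_mem_eigI]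
  simp [neg_eq_iff_eq_neg]

theorem finrank_conjSub (S : Submodule ℂ (Cx V)) :
    Module.finrank ℂ (conjSub S) = Module.finrank ℂ S := by
  let j : S ≃+ conjSub S :=
    { toFun := fun v => ⟨cxConj v.1, by
        change cxConj (cxConj v.1) ∈ S
        rw [cxConj_cxConj]; exact v.2⟩
      invFun := fun v => ⟨cxConj v.1, v.2⟩
      left_inv := fun v => Subtype.ext (cxConj_cxConj _)
      right_inv := fun v => Subtype.ext (cxConj_cxConj _)
      map_add' := fun v w => Subtype.ext (map_add _ _ _) }
  -- Conjugation is only semilinear, so ranks are compared along the conjugation automorphism of ℂ.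
  have h := rank_eq_of_equiv_equiv (starRingEnd ℂ) j
    (starRingAut (R := ℂ)).bijective (fun r m => Subtype.ext (cxConj_smul r m.1))
  rw [Module.finrank, Module.finrank, h]

theorem disjoint_eigI_neg (A : Module.End ℝ V) : Disjoint (eigI A) (eigI (-A)) := by
  rw [Submodule.disjoint_def]
  intro z hz hz'
  obtain ⟨a, b, rfl⟩ := exists_eq_cxMk z
  rw [cxMk_mem_eigI] at hz hz'
  simp only [LinearMap.neg_apply, hz.1, hz.2, neg_neg] at hz'
  have h0 : ∀ y : V, y = -y → y = 0 := fun y hy => by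
    have : (2 : ℝ) • y = 0 := by rw [two_smul]; exact add_eq_zero_iff_eq_neg.2 hy
    exact (smul_eq_zero.1 this).resolve_left two_ne_zero
  rw [h0 b hz'.1, h0 a hz'.2.symm, cxMk_zero]

theorem formBaseChange_symm {B : LinearMap.BilinForm ℝ V} (hB : B.IsSymm) :
    (LinearMap.BilinForm.baseChange ℂ B).IsSymm := ⟨fun z w => by
  obtain ⟨a, b, rfl⟩ := exists_eq_cxMk z
  obtain ⟨c, d, rfl⟩ := exists_eq_cxMk w
  rw [formBaseChange_cxMk, formBaseChange_cxMk, hB.eq a c, hB.eq b d, hB.eq a d, hB.eq b c,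
    add_comm (B d a)]⟩

/-- `A` is skew-adjoint for `B`, satisfies `A³ = -A`, and its kernel is the line spanned by `u`. -/
structure IsSkewCube (B : LinearMap.BilinForm ℝ V) (u : V) (A : Module.End ℝ V) : Prop where
  skew : ∀ v w, B (A v) w = -B v (A w)
  cube : ∀ v, A (A (A v)) = -A v
  map_u : A u = 0
  ker : ∀ v, A v = 0 → ∃ c : ℝ, v = c • u

/-- The projection `-(A² + i A) / 2` onto the `i`-eigenspace along the other eigenspaces, applied
to `a + i b`. -/
def eigProj (A : Module.End ℝ V) (a b : V) : V × V :=
  (-(2⁻¹ : ℝ) • (A (A a) - A b), -(2⁻¹ : ℝ) • (A (A b) + A a))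

namespace IsSkewCube

variable {B : LinearMap.BilinForm ℝ V} {u : V} {A : Module.End ℝ V}

theorem neg (h : IsSkewCube B u A) : IsSkewCube B u (-A) where
  skew v w := by simp [h.skew v w]
  cube v := by simp [h.cube v]
  map_u := by simp [h.map_u]
  ker v hv := h.ker v (by simpa using hv)

theorem eigProj_mem (h : IsSkewCube B u A) (a b : V) :
    cxMk (eigProj A a b).1 (eigProj A a b).2 ∈ eigI A := by
  rw [cxMk_mem_eigI]
  simp only [eigProj, map_smul, map_sub, map_add, h.cube]
  constructor <;> module

/-- Skewness gives i⟨z,w⟩ = -i⟨z,w⟩ on the i-eigenspace. -/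
theorem form_eq_zero (h : IsSkewCube B u A) {z w : Cx V} (hz : z ∈ eigI A) (hw : w ∈ eigI A) :
    LinearMap.BilinForm.baseChange ℂ B z w = 0 := by
  obtain ⟨a, b, rfl⟩ := exists_eq_cxMk z
  obtain ⟨c, d, rfl⟩ := exists_eq_cxMk w
  rw [cxMk_mem_eigI] at hz hw
  rw [formBaseChange_cxMk]
  have h1 := h.skew b d
  have h2 := h.skew a d
  rw [hz.2, hw.2] at h1
  rw [hz.1, hw.2] at h2
  have h3 := h.skew b c
  rw [hz.2, hw.1] at h3
  simp only [map_neg, LinearMap.neg_apply] at h2 h3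
  have h4 := h.skew a c
  rw [hz.1, hw.1] at h4
  simp only [map_neg, LinearMap.neg_apply] at h4
  apply Complex.ext <;> simp <;> linarith

/-- The eigenspace lies in the image of A, and skewness makes the image orthogonal to the kernel. -/
theorem form_u_eq_zero (h : IsSkewCube B u A) {w : Cx V} (hw : w ∈ eigI A) :
    LinearMap.BilinForm.baseChange ℂ B (cxMk u 0) w = 0 := by
  obtain ⟨c, d, rfl⟩ := exists_eq_cxMk w
  rw [cxMk_mem_eigI] at hw
  have h1 := h.skew u c
  have h2 := h.skew u d
  rw [h.map_u, hw.1] at h1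
  rw [h.map_u, hw.2] at h2
  rw [formBaseChange_cxMk]
  simp only [map_neg, map_zero, LinearMap.zero_apply, neg_neg] at h1 h2 ⊢
  apply Complex.ext <;> simp <;> linarith

/-- A vector orthogonal to the `i`-eigenspace and to the kernel lies in the `i`-eigenspace. -/
theorem mem_eigI (h : IsSkewCube B u A) (hB : B.Nondegenerate) (hu : B u u ≠ 0)
    {z : Cx V} (hz : ∀ w ∈ eigI A, LinearMap.BilinForm.baseChange ℂ B z w = 0)
    (hzu : LinearMap.BilinForm.baseChange ℂ B z (cxMk u 0) = 0) : z ∈ eigI A := by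
  obtain ⟨a, b, rfl⟩ := exists_eq_cxMk z
  rw [formBaseChange_cxMk] at hzu
  have hau : B a u = 0 := by simpa using congrArg Complex.re hzu
  have hbu : B b u = 0 := by simpa using congrArg Complex.im hzu
  -- By A³ = -A the vector y + A²y is a multiple of u. Its pairing with u equals that of y, so it
  -- vanishes when y is orthogonal to u.
  have key : ∀ y, y + A (A y) = 0 ∨ B y u ≠ 0 := fun y => by
    obtain ⟨c, hc⟩ := h.ker (y + A (A y)) (by rw [map_add, h.cube]; abel)
    by_cases hy : B y u = 0
    · left
      have : B (y + A (A y)) u = c * B u u := by rw [hc]; simp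
      rw [map_add, LinearMap.add_apply, hy, h.skew, h.map_u] at this
      have hc0 : c = 0 := by
        have : c * B u u = 0 := by rw [← this]; simp
        exact (mul_eq_zero.1 this).resolve_right hu
      rw [hc, hc0, zero_smul]
    · exact Or.inr hy
  have ha : A (A a) = -a := eq_neg_of_add_eq_zero_right ((key a).resolve_right (by simp [hau]))
  have hb : A (A b) = -b := eq_neg_of_add_eq_zero_right ((key b).resolve_right (by simp [hbu]))
  -- Twice the real part of the pairing of a + ib with the eigenprojection of the real vector y is B
  -- (a - A b) y.
  have hmain : ∀ y, B (a - A b) y = 0 := fun y => by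
    have := congrArg Complex.re (hz _ (h.eigProj_mem y 0))
    rw [formBaseChange_cxMk] at this
    simp only [eigProj, map_zero, sub_zero, zero_add, map_smul, smul_eq_mul,
      Complex.zero_re] at this
    have e1 : B a (A (A y)) = -B a y := by
      have := h.skew (A a) y
      have h2 := h.skew a (A y)
      rw [ha] at this
      simp only [map_neg, LinearMap.neg_apply] at this
      linarith
    have e2 := h.skew b y
    rw [map_sub, LinearMap.sub_apply]
    rw [e1] at this
    linarith
  have hA : a - A b = 0 := hB.1 _ hmain
  have hAb : A b = a := (sub_eq_zero.1 hA).symm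
  rw [cxMk_mem_eigI]
  exact ⟨by rw [← hAb, hb], hAb⟩

/-- The two eigenprojections sum to -A², and 1 + A² takes values in the kernel of A. -/
theorem eq_add_eigProj (h : IsSkewCube B u A) (a b : V) :
    ∃ c : ℂ, cxMk a b = cxMk (eigProj A a b).1 (eigProj A a b).2
      + cxMk (eigProj (-A) a b).1 (eigProj (-A) a b).2 + c • cxMk u 0 := by
  obtain ⟨c, hc⟩ := h.ker (a + A (A a)) (by rw [map_add, h.cube]; abel)
  obtain ⟨d, hd⟩ := h.ker (b + A (A b)) (by rw [map_add, h.cube]; abel)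
  refine ⟨⟨c, d⟩, ?_⟩
  rw [smul_cxMk, cxMk_add, cxMk_add, cxMk_inj]
  simp only [eigProj, LinearMap.neg_apply, map_neg, smul_zero, sub_zero, zero_add, neg_neg, ← hc,
    ← hd]
  constructor <;> module

/-- The complexification is the sum of two conjugate, hence equidimensional, eigenspaces and the
line of u. This yields the rank of L₂, which is not given in advance. -/
theorem finrank_eigI [FiniteDimensional ℝ V] (h : IsSkewCube B u A) (hu : u ≠ 0) :
    2 * Module.finrank ℂ (eigI A) + 1 = Module.finrank ℝ V := by
  have hdis := disjoint_eigI_neg A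
  have e1 := Submodule.finrank_sup_add_finrank_inf_eq (eigI A) (eigI (-A))
  rw [hdis.eq_bot, finrank_bot, add_zero, ← conjSub_eigI, finrank_conjSub] at e1
  rw [conjSub_eigI] at e1
  have hu' : cxMk u 0 ≠ 0 := fun h0 => hu (by simpa using congrArg cxRe h0)
  have hcompl : IsCompl (eigI A ⊔ eigI (-A)) (ℂ ∙ cxMk u 0) := by
    constructor
    · rw [Submodule.disjoint_def]
      intro z hz hz'
      obtain ⟨c, rfl⟩ := Submodule.mem_span_singleton.1 hz'
      obtain ⟨x, hx, y, hy, hxy⟩ := Submodule.mem_sup.1 hz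
      have hx' := Module.End.mem_eigenspace_iff.1 hx
      have hy' := Module.End.mem_eigenspace_iff.1 hy
      have h0 : LinearMap.baseChange ℂ A (c • cxMk u 0) = 0 := by
        rw [map_smul, baseChange_cxMk, h.map_u, map_zero, cxMk_zero, smul_zero]
      have hy2 : LinearMap.baseChange ℂ A y = -(Complex.I • y) := by
        rw [← hy', LinearMap.baseChange_neg, LinearMap.neg_apply, neg_neg]
      rw [← hxy, map_add, hx', hy2, ← sub_eq_add_neg, ← smul_sub] at h0
      have hxy' : x = y := sub_eq_zero.1 ((smul_eq_zero.1 h0).resolve_left Complex.I_ne_zero)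
      have hx0 := Submodule.disjoint_def.1 hdis x hx (hxy' ▸ hy)
      rw [← hxy, ← hxy', hx0, add_zero]
    · rw [codisjoint_iff, eq_top_iff]
      intro z _
      obtain ⟨a, b, rfl⟩ := exists_eq_cxMk z
      obtain ⟨c, hc⟩ := h.eq_add_eigProj a b
      rw [hc]
      exact Submodule.add_mem_sup (Submodule.add_mem_sup (h.eigProj_mem a b)
        (h.neg.eigProj_mem a b)) (Submodule.smul_mem _ _ (Submodule.mem_span_singleton_self _))
  have e2 := Submodule.finrank_add_eq_of_isCompl hcompl
  rw [finrank_span_singleton hu', e1, Module.finrank_baseChange] at e2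
  omega

end IsSkewCube

/-- An endomorphism whose `i`-eigenspace `L` has half the dimension minus one, is isotropic, and
which vanishes on `(L ⊕ L̄)^⊥` is skew-adjoint with cube `-A` and one-dimensional kernel. -/
theorem isSkewCube_of_eigI [FiniteDimensional ℝ V] {B : LinearMap.BilinForm ℝ V} {u : V}
    {A : Module.End ℝ V} (hB : B.IsSymm)
    (hdim : 2 * Module.finrank ℂ (eigI A) + 1 = Module.finrank ℝ V)
    (hiso : ∀ v ∈ eigI A, ∀ w ∈ eigI A, LinearMap.BilinForm.baseChange ℂ B v w = 0)
    (hker : ∀ w : Cx V, (∀ v ∈ eigI A ⊔ conjSub (eigI A),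
      LinearMap.BilinForm.baseChange ℂ B w v = 0) → LinearMap.baseChange ℂ A w = 0)
    (hu : u ≠ 0) (hAu : A u = 0) : IsSkewCube B u A := by
  set Bc := LinearMap.BilinForm.baseChange ℂ B with hBc
  have hsymm : Bc.IsSymm := formBaseChange_symm hB
  have hiso' : ∀ v ∈ conjSub (eigI A), ∀ w ∈ conjSub (eigI A), Bc v w = 0 := by
    intro z hz w hw
    obtain ⟨a, b, rfl⟩ := exists_eq_cxMk z
    obtain ⟨c, d, rfl⟩ := exists_eq_cxMk w
    have h := hiso _ (cxMk_mem_conjSub.1 hz) _ (cxMk_mem_conjSub.1 hw)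
    rw [formBaseChange_cxMk] at h
    have h1 := congrArg Complex.re h
    have h2 := congrArg Complex.im h
    simp only [map_neg, LinearMap.neg_apply, Complex.zero_re, Complex.zero_im] at h1 h2
    rw [hBc, formBaseChange_cxMk]
    apply Complex.ext <;> simp <;> linarith
  rw [conjSub_eigI] at hiso' hker
  have hAx : ∀ x ∈ eigI A, LinearMap.baseChange ℂ A x = Complex.I • x := fun x hx =>
    Module.End.mem_eigenspace_iff.1 hx
  have hAy : ∀ y ∈ eigI (-A), LinearMap.baseChange ℂ A y = -(Complex.I • y) := fun y hy => by
    rw [← Module.End.mem_eigenspace_iff.1 hy, LinearMap.baseChange_neg, LinearMap.neg_apply,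
      neg_neg]
  have hdis := disjoint_eigI_neg A
  set W := eigI A ⊔ eigI (-A) with hW
  have hWker : ∀ z ∈ W, LinearMap.baseChange ℂ A z = 0 → z = 0 := by
    intro z hz h0
    obtain ⟨x, hx, y, hy, rfl⟩ := Submodule.mem_sup.1 hz
    rw [map_add, hAx x hx, hAy y hy, ← sub_eq_add_neg, ← smul_sub] at h0
    have hxy : x = y := sub_eq_zero.1 ((smul_eq_zero.1 h0).resolve_left Complex.I_ne_zero)
    rw [← hxy, Submodule.disjoint_def.1 hdis x hx (hxy ▸ hy), add_zero]
  have horth : ∀ z, z ∈ Bc.orthogonal W ↔ ∀ w ∈ W, Bc z w = 0 := fun z => by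
    rw [LinearMap.BilinForm.mem_orthogonal_iff]
    exact forall₂_congr fun w _ => by
      change Bc w z = 0 ↔ _
      rw [hsymm.eq w z]
  -- A is injective on W = L ⊕ L̄ and kills W^⊥, so W ∩ W^⊥ = 0. The space then splits as W ⊕ W^⊥,
  -- and the dimension count leaves a line for W^⊥ = Ker A.
  have hnd : (Bc.restrict W).Nondegenerate :=
    LinearMap.BilinForm.nondegenerate_restrict_of_disjoint_orthogonal Bc hsymm.isRefl
      (Submodule.disjoint_def.2 fun z hz hz' => hWker z hz (hker z ((horth z).1 hz')))
  have hcompl := LinearMap.BilinForm.isCompl_orthogonal_of_restrict_nondegenerate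
    hsymm.isRefl hnd
  have hdec : ∀ z : Cx V, ∃ x ∈ eigI A, ∃ y ∈ eigI (-A), ∃ c ∈ Bc.orthogonal W,
      z = x + y + c := by
    intro z
    have hz : z ∈ W ⊔ Bc.orthogonal W := by rw [hcompl.sup_eq_top]; trivial
    obtain ⟨w, hw, c, hc, rfl⟩ := Submodule.mem_sup.1 hz
    obtain ⟨x, hx, y, hy, rfl⟩ := Submodule.mem_sup.1 hw
    exact ⟨x, hx, y, hy, c, hc, rfl⟩
  have hAc : ∀ c ∈ Bc.orthogonal W, LinearMap.baseChange ℂ A c = 0 := fun c hc =>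
    hker c ((horth c).1 hc)
  have hkerW : ∀ z, LinearMap.baseChange ℂ A z = 0 → z ∈ Bc.orthogonal W := by
    intro z h0
    obtain ⟨x, hx, y, hy, c, hc, rfl⟩ := hdec z
    have hxy : x + y ∈ W := Submodule.add_mem_sup hx hy
    rw [map_add, hAc c hc, add_zero] at h0
    rw [hWker _ hxy h0, zero_add]
    exact hc
  have hrank : Module.finrank ℂ (Bc.orthogonal W) = 1 := by
    have e1 := Submodule.finrank_sup_add_finrank_inf_eq (eigI A) (eigI (-A))
    rw [hdis.eq_bot, finrank_bot, add_zero, ← conjSub_eigI, finrank_conjSub, conjSub_eigI] at e1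
    have e2 := Submodule.finrank_add_eq_of_isCompl hcompl
    rw [e1, Module.finrank_baseChange] at e2
    rw [← hdim, two_mul] at e2
    exact Nat.add_left_cancel e2
  refine ⟨fun v w => ?_, fun v => ?_, hAu, fun v hv => ?_⟩
  · have hc : ∀ z z', Bc (LinearMap.baseChange ℂ A z) z' = -Bc z (LinearMap.baseChange ℂ A z') := by
      intro z z'
      obtain ⟨x, hx, y, hy, c, hc, rfl⟩ := hdec z
      obtain ⟨x', hx', y', hy', c', hc', rfl⟩ := hdec z'
      have o1 := (horth c).1 hc x' (Submodule.mem_sup_left hx')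
      have o2 := (horth c).1 hc y' (Submodule.mem_sup_right hy')
      have o3 := (hsymm.eq x c').trans ((horth c').1 hc' x (Submodule.mem_sup_left hx))
      have o4 := (hsymm.eq y c').trans ((horth c').1 hc' y (Submodule.mem_sup_right hy))
      simp only [map_add, hAx x hx, hAy y hy, hAc c hc, hAx x' hx', hAy y' hy', hAc c' hc',
        LinearMap.add_apply, map_neg, LinearMap.neg_apply, map_smul, LinearMap.smul_apply,
        hiso x hx x' hx', hiso' y hy y' hy', o1, o2, o3, o4, map_zero, LinearMap.zero_apply,
        smul_eq_mul]
      ring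
    have := congrArg Complex.re (hc (cxMk v 0) (cxMk w 0))
    rw [hBc, baseChange_cxMk, baseChange_cxMk, formBaseChange_cxMk, formBaseChange_cxMk] at this
    simpa using this
  · have hc : ∀ z, LinearMap.baseChange ℂ A (LinearMap.baseChange ℂ A (LinearMap.baseChange ℂ A z))
        = -LinearMap.baseChange ℂ A z := by
      intro z
      obtain ⟨x, hx, y, hy, c, hc, rfl⟩ := hdec z
      simp only [map_add, hAx x hx, hAy y hy, hAc c hc, map_neg, map_smul, map_zero, smul_smul,
        smul_neg, Complex.I_mul_I]
      module
    have := hc (cxMk v 0)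
    rw [baseChange_cxMk, baseChange_cxMk, baseChange_cxMk, cxMk_neg, cxMk_inj] at this
    exact this.1
  · have huW : cxMk u 0 ∈ Bc.orthogonal W := hkerW _ (by rw [baseChange_cxMk, hAu]; simp)
    have hvW : cxMk v 0 ∈ Bc.orthogonal W := hkerW _ (by rw [baseChange_cxMk, hv]; simp)
    have hu' : (⟨_, huW⟩ : Bc.orthogonal W) ≠ 0 := fun h0 =>
      hu (by simpa using congrArg (fun z => cxRe z.1) h0)
    obtain ⟨c, hc⟩ := (finrank_eq_one_iff_of_nonzero' _ hu').1 hrank ⟨_, hvW⟩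
    -- Both u and v are real, so the real part of the complex coefficient already does the job.
    refine ⟨c.re, ?_⟩
    have := congrArg (fun z => cxRe z.1) hc
    simpa [smul_cxMk] using this.symm

end ComplexifiedLinearAlgebra

/-! ### Sections of the complexified bundle and the Courant identities on orthogonal sections. -/

section ComplexSections

variable {n : ℕ} {M : Type*} [TopologicalSpace M] [ChartedSpace (EuclideanSpace ℝ (Fin n)) M]
  [IsManifold (𝓡 n) ∞ M]
  {R : Type*} [NormedAddCommGroup R] [NormedSpace ℝ R]
  {E : M → Type*} [TopologicalSpace (TotalSpace R E)] [∀ x, TopologicalSpace (E x)]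
  [∀ x, AddCommGroup (E x)] [∀ x, Module ℝ (E x)] [FiberBundle R E] [VectorBundle ℝ R E]
  [ContMDiffVectorBundle ∞ R E (𝓡 n)]

theorem dirDeriv_add {f g : M → ℝ} (hf : SmoothFun n f) (hg : SmoothFun n g) (x : M)
    (X : TangentSpace (𝓡 n) x) :
    dirDeriv (fun y => f y + g y) x X = dirDeriv f x X + dirDeriv g x X := by
  have hf' : MDifferentiableAt (𝓡 n) 𝓘(ℝ, ℝ) f x := hf.mdifferentiable (by simp) x
  have hg' : MDifferentiableAt (𝓡 n) 𝓘(ℝ, ℝ) g x := hg.mdifferentiable (by simp) x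
  have h := mvfderiv_add hf' hg'
  exact congrArg (fun l => l X) h

theorem dirDeriv_neg (f : M → ℝ) (x : M) (X : TangentSpace (𝓡 n) x) :
    dirDeriv (fun y => -f y) x X = -dirDeriv f x X := by
  have h := mvfderiv_neg (I := 𝓡 n) (g := f) (x := x)
  exact congrArg (fun l => l X) h

theorem dirDeriv_const (c : ℝ) (x : M) (X : TangentSpace (𝓡 n) x) :
    dirDeriv (fun _ => c) x X = 0 := by
  have h := mvfderiv_const (I := 𝓡 n) c (x := x)
  exact congrArg (fun l => l X) h

namespace CSec

theorem eval_add (s t : CSec n R E) (x : M) : eval (s + t) x = eval s x + eval t x :=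
  (cxMk_add _ _ _ _).symm

theorem eval_zero (x : M) : eval (0 : CSec n R E) x = 0 := cxMk_zero

/-- The complex conjugate of a section of `E_ℂ`. -/
def conj (s : CSec n R E) : CSec n R E := (s.1, -s.2)

theorem eval_conj (s : CSec n R E) (x : M) : eval s.conj x = cxConj (eval s x) :=
  (cxConj_cxMk _ _).symm

/-- The product of a section of `E_ℂ` with a complex number. -/
def csmul (c : ℂ) (s : CSec n R E) : CSec n R E :=
  (c.re • s.1 - c.im • s.2, c.re • s.2 + c.im • s.1)

theorem eval_csmul (c : ℂ) (s : CSec n R E) (x : M) : eval (csmul c s) x = c • eval s x :=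
  (smul_cxMk _ _ _).symm

/-- The values of the sections of `E_ℂ` at a point, as a complex subspace. -/
def values (n : ℕ) {M : Type*} [TopologicalSpace M] [ChartedSpace (EuclideanSpace ℝ (Fin n)) M]
    [IsManifold (𝓡 n) ∞ M]
    (R : Type*) [NormedAddCommGroup R] [NormedSpace ℝ R]
    (E : M → Type*) [TopologicalSpace (TotalSpace R E)] [∀ x, TopologicalSpace (E x)]
    [∀ x, AddCommGroup (E x)] [∀ x, Module ℝ (E x)] [FiberBundle R E] [VectorBundle ℝ R E]
    [ContMDiffVectorBundle ∞ R E (𝓡 n)] (x : M) : Submodule ℂ (Cx (E x)) where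
  carrier := {z | ∃ s : CSec n R E, eval s x = z}
  add_mem' := by
    rintro _ _ ⟨s, rfl⟩ ⟨t, rfl⟩
    exact ⟨s + t, eval_add s t x⟩
  zero_mem' := ⟨0, eval_zero x⟩
  smul_mem' := by
    rintro c _ ⟨s, rfl⟩
    exact ⟨csmul c s, eval_csmul c s x⟩

theorem eval_mem_values (s : CSec n R E) (x : M) : eval s x ∈ values n R E x := ⟨s, rfl⟩

theorem conj_mem_values {x : M} {z : Cx (E x)} (hz : z ∈ values n R E x) :
    cxConj z ∈ values n R E x := by
  obtain ⟨s, rfl⟩ := hz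
  exact ⟨s.conj, eval_conj s x⟩

end CSec

theorem isSectionOf_conj {S : ∀ x, Submodule ℂ (Cx (E x))} {s : CSec n R E} :
    IsSectionOf S s.conj ↔ IsSectionOf (fun x => conjSub (S x)) s :=
  forall_congr' fun x => by rw [CSec.eval_conj]; rfl

/-- The real section `u`, as a section of `E_ℂ`. -/
def realSec (u : Sec n R E) : CSec n R E := (u, 0)

/-- The section obtained by applying a smooth field of endomorphisms. -/
def applyEnd {A : ∀ x, Module.End ℝ (E x)}
    (hA : ∀ s : Sec n R E, SmoothSection n R (fun x => A x (s x))) (s : Sec n R E) : Sec n R E :=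
  ⟨fun x => A x (s x), hA s⟩

namespace CourantAlgebroid

variable (C : CourantAlgebroid n R E)

theorem formC_eval (s t : CSec n R E) (x : M) :
    C.formC x (s.eval x) (t.eval x)
      = ⟨C.form x (s.1 x) (t.1 x) - C.form x (s.2 x) (t.2 x),
          C.form x (s.1 x) (t.2 x) + C.form x (s.2 x) (t.1 x)⟩ :=
  formBaseChange_cxMk _ _ _ _ _

theorem formC_symm (x : M) (z w : Cx (E x)) : C.formC x z w = C.formC x w z :=
  (formBaseChange_symm (C.form_symm x)).eq z w

/-- Polarization of `bracket_self`: the symmetric part of the Dorfman bracket is a derivative of the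
pairing, so it disappears for orthogonal sections. -/
theorem form_bracket_add_bracket (u v w : Sec n R E) (x : M) :
    C.form x (C.bracket u v x) (w x) + C.form x (C.bracket v u x) (w x)
      = dirDeriv (fun y => C.form y (u y) (v y)) x (C.anchor x (w x)) := by
  have h := C.bracket_self (u + v) w x
  have hf : (fun y => C.form y ((u + v) y) ((u + v) y))
      = fun y => (C.form y (u y) (u y) + C.form y (v y) (v y))
        + (C.form y (u y) (v y) + C.form y (u y) (v y)) := by
    funext y
    rw [ContMDiffSection.coe_add, Pi.add_apply]
    simp only [map_add, LinearMap.add_apply]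
    rw [(C.form_symm y).eq (v y) (u y)]
    ring
  have hs := C.form_smooth
  have hadd : ∀ {f g : M → ℝ}, SmoothFun n f → SmoothFun n g → SmoothFun n (fun y => f y + g y) :=
    fun hf hg => ContMDiff.add hf hg
  rw [hf, dirDeriv_add (hadd (hs u u) (hs v v)) (hadd (hs u v) (hs u v)),
    dirDeriv_add (hs u u) (hs v v), dirDeriv_add (hs u v) (hs u v), ← C.bracket_self u w x,
    ← C.bracket_self v w x] at h
  simp only [map_add, LinearMap.add_apply, ContMDiffSection.coe_add, Pi.add_apply] at h
  linarith

/-- The derivative terms in metric compatibility cancel because the real and imaginary parts of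
⟨v,w⟩ vanish identically on M, not only at x. -/
theorem formC_bracket_real {v w : CSec n R E}
    (h : ∀ y, C.formC y (v.eval y) (w.eval y) = 0) (u : Sec n R E) (x : M) :
    C.formC x (CSec.eval (C.bracket u v.1, C.bracket u v.2) x) (w.eval x)
      + C.formC x (v.eval x) (CSec.eval (C.bracket u w.1, C.bracket u w.2) x) = 0 := by
  simp only [formC_eval] at h ⊢
  have hre : (fun y => C.form y (v.1 y) (w.1 y)) = fun y => C.form y (v.2 y) (w.2 y) :=
    funext fun y => sub_eq_zero.1 (congrArg Complex.re (h y))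
  have him : (fun y => C.form y (v.1 y) (w.2 y)) = fun y => -C.form y (v.2 y) (w.1 y) :=
    funext fun y => eq_neg_of_add_eq_zero_left (congrArg Complex.im (h y))
  have h11 := C.metric_compat u v.1 w.1 x
  have h22 := C.metric_compat u v.2 w.2 x
  have h12 := C.metric_compat u v.1 w.2 x
  have h21 := C.metric_compat u v.2 w.1 x
  rw [hre] at h11
  rw [him, dirDeriv_neg] at h12
  apply Complex.ext <;> simp <;> linarith

theorem eval_bracketC (u v : CSec n R E) (x : M) :
    (C.bracketC u v).eval x = CSec.eval (C.bracket u.1 v.1, C.bracket u.1 v.2) x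
      + Complex.I • CSec.eval (C.bracket u.2 v.1, C.bracket u.2 v.2) x := by
  simp only [CSec.eval, I_smul_cxMk, cxMk_add, bracketC, ContMDiffSection.coe_add,
    ContMDiffSection.coe_sub, Pi.add_apply, Pi.sub_apply]
  rw [sub_eq_add_neg]

/-- The Dorfman bracket is a derivation of the scalar product of orthogonal sections. -/
theorem formC_bracketC {v w : CSec n R E}
    (h : ∀ y, C.formC y (v.eval y) (w.eval y) = 0) (u : CSec n R E) (x : M) :
    C.formC x ((C.bracketC u v).eval x) (w.eval x)
      = -C.formC x (v.eval x) ((C.bracketC u w).eval x) := by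
  have h1 := C.formC_bracket_real h u.1 x
  have h2 := C.formC_bracket_real h u.2 x
  rw [eval_bracketC, eval_bracketC]
  simp only [map_add, map_smul, LinearMap.add_apply, LinearMap.smul_apply, smul_eq_mul]
  linear_combination h1 + Complex.I * h2

/-- The Dorfman bracket of orthogonal sections is skew-symmetric. -/
theorem formC_bracketC_swap {u v : CSec n R E}
    (h : ∀ y, C.formC y (u.eval y) (v.eval y) = 0) (w : CSec n R E) (x : M) :
    C.formC x ((C.bracketC u v).eval x) (w.eval x)
      = -C.formC x ((C.bracketC v u).eval x) (w.eval x) := by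
  have hre : (fun y => C.form y (u.1 y) (v.1 y)) = fun y => C.form y (u.2 y) (v.2 y) :=
    funext fun y => sub_eq_zero.1 (by simpa [formC_eval] using congrArg Complex.re (h y))
  have him : (fun y => C.form y (u.1 y) (v.2 y)) = fun y => -C.form y (u.2 y) (v.1 y) :=
    funext fun y => eq_neg_of_add_eq_zero_left
      (by simpa [formC_eval] using congrArg Complex.im (h y))
  have e11 := fun w => C.form_bracket_add_bracket u.1 v.1 w x
  have e22 := fun w => C.form_bracket_add_bracket u.2 v.2 w x
  have e12 := fun w => C.form_bracket_add_bracket u.1 v.2 w x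
  have e21 := fun w => C.form_bracket_add_bracket u.2 v.1 w x
  rw [hre] at e11
  simp only [him, dirDeriv_neg] at e12
  have a1 := e11 w.1
  have a2 := e11 w.2
  have b1 := e22 w.1
  have b2 := e22 w.2
  have c1 := e12 w.1
  have c2 := e12 w.2
  have d1 := e21 w.1
  have d2 := e21 w.2
  simp only [formC_eval, bracketC, ContMDiffSection.coe_add, ContMDiffSection.coe_sub,
    Pi.add_apply, Pi.sub_apply, map_add, map_sub, LinearMap.add_apply, LinearMap.sub_apply]
  apply Complex.ext <;> simp <;> linarith

theorem bracketC_conj (u v : CSec n R E) :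
    C.bracketC u.conj v.conj = (C.bracketC u v).conj := by
  simp only [bracketC, CSec.conj, map_neg, LinearMap.neg_apply, neg_neg]
  rw [neg_add]

theorem bracketC_realSec (u : Sec n R E) (v : CSec n R E) :
    C.bracketC (realSec u) v = (C.bracket u v.1, C.bracket u v.2) := by
  simp [bracketC, realSec]

theorem bracketC_add_left (u u' v : CSec n R E) :
    C.bracketC (u + u') v = C.bracketC u v + C.bracketC u' v := by
  simp only [bracketC, Prod.fst_add, Prod.snd_add, map_add, LinearMap.add_apply, Prod.mk_add_mk]
  congr 1 <;> abel

theorem bracketC_add_right (u v v' : CSec n R E) :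
    C.bracketC u (v + v') = C.bracketC u v + C.bracketC u v' := by
  simp only [bracketC, Prod.fst_add, Prod.snd_add, map_add, Prod.mk_add_mk]
  congr 1 <;> abel

theorem integrableSub_conjSub {S : ∀ x, Submodule ℂ (Cx (E x))} (h : C.IntegrableSub S) :
    C.IntegrableSub (fun x => conjSub (S x)) := fun u v hu hv => by
  rw [← isSectionOf_conj] at hu hv ⊢
  rw [← bracketC_conj]
  exact h _ _ hu hv

theorem liePreserves_conjSub {u : Sec n R E} {S : ∀ x, Submodule ℂ (Cx (E x))}
    (h : C.LiePreserves u S) : C.LiePreserves u (fun x => conjSub (S x)) := fun v hv => by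
  rw [← isSectionOf_conj] at hv
  rw [← isSectionOf_conj]
  have e : CSec.conj (C.bracket u v.1, C.bracket u v.2)
      = (C.bracket u v.conj.1, C.bracket u v.conj.2) := by simp [CSec.conj]
  rw [e]
  exact h _ hv

theorem IntegrableSub.inf {S T : ∀ x, Submodule ℂ (Cx (E x))} (hS : C.IntegrableSub S)
    (hT : C.IntegrableSub T) : C.IntegrableSub (fun x => S x ⊓ T x) := fun u v hu hv x =>
  ⟨hS u v (fun y => (hu y).1) (fun y => (hv y).1) x,
    hT u v (fun y => (hu y).2) (fun y => (hv y).2) x⟩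

theorem LiePreserves.inf {u : Sec n R E} {S T : ∀ x, Submodule ℂ (Cx (E x))}
    (hS : C.LiePreserves u S) (hT : C.LiePreserves u T) :
    C.LiePreserves u (fun x => S x ⊓ T x) := fun v hv x =>
  ⟨hS v (fun y => (hv y).1) x, hT v (fun y => (hv y).2) x⟩

end CourantAlgebroid

end ComplexSections

/-! ### Smooth skew fields with A³ = -A, and the integrability arguments. -/

section SkewCubeFields

variable {n : ℕ} {M : Type*} [TopologicalSpace M] [ChartedSpace (EuclideanSpace ℝ (Fin n)) M]
  [IsManifold (𝓡 n) ∞ M]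
  {R : Type*} [NormedAddCommGroup R] [NormedSpace ℝ R]
  {E : M → Type*} [TopologicalSpace (TotalSpace R E)] [∀ x, TopologicalSpace (E x)]
  [∀ x, AddCommGroup (E x)] [∀ x, Module ℝ (E x)] [FiberBundle R E] [VectorBundle ℝ R E]
  [ContMDiffVectorBundle ∞ R E (𝓡 n)]

/-- A smooth field of skew-adjoint endomorphisms with `A³ = -A` and kernel spanned by `u`. -/
structure IsSkewCubeField (C : CourantAlgebroid n R E) (u : Sec n R E)
    (A : ∀ x, Module.End ℝ (E x)) : Prop where
  smooth : ∀ s : Sec n R E, SmoothSection n R (fun x => A x (s x))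
  isSkewCube : ∀ x, IsSkewCube (C.form x) (u x) (A x)

/-- The section of `E_ℂ` obtained by projecting to the `i`-eigenbundle of `A`. -/
def eigProjSec {A : ∀ x, Module.End ℝ (E x)}
    (hA : ∀ s : Sec n R E, SmoothSection n R (fun x => A x (s x))) (s : CSec n R E) :
    CSec n R E :=
  (-(2⁻¹ : ℝ) • (applyEnd hA (applyEnd hA s.1) - applyEnd hA s.2),
    -(2⁻¹ : ℝ) • (applyEnd hA (applyEnd hA s.2) + applyEnd hA s.1))

theorem eval_eigProjSec {A : ∀ x, Module.End ℝ (E x)}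
    (hA : ∀ s : Sec n R E, SmoothSection n R (fun x => A x (s x))) (s : CSec n R E) (x : M) :
    (eigProjSec hA s).eval x
      = cxMk (eigProj (A x) (s.1 x) (s.2 x)).1 (eigProj (A x) (s.1 x) (s.2 x)).2 := rfl

theorem eigProj_of_mem {V : Type*} [AddCommGroup V] [Module ℝ V] {A : Module.End ℝ V} {a b : V}
    (h : cxMk a b ∈ eigI A) : eigProj A a b = (a, b) := by
  rw [cxMk_mem_eigI] at h
  simp only [eigProj, h.1, h.2, map_neg, Prod.mk.injEq]
  constructor <;> module

/-- The two projections sum to -A² = -B², which is the identity on the i-eigenspace of B. With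
`eigProj_mem_of_commute` this splits that eigenspace along the eigenspaces of A and -A. -/
theorem eigProj_add_neg {V : Type*} [AddCommGroup V] [Module ℝ V] {A B : Module.End ℝ V}
    (hsq : ∀ v, A (A v) = B (B v)) {a b : V} (h : cxMk a b ∈ eigI B) :
    eigProj A a b + eigProj (-A) a b = (a, b) := by
  rw [cxMk_mem_eigI] at h
  simp only [eigProj, LinearMap.neg_apply, map_neg, neg_neg, hsq, h.1, h.2, Prod.mk_add_mk,
    Prod.mk.injEq]
  constructor <;> module

theorem eigProj_mem_of_commute {V : Type*} [AddCommGroup V] [Module ℝ V] {A B : Module.End ℝ V}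
    (hAB : ∀ v, A (B v) = B (A v)) {a b : V} (h : cxMk a b ∈ eigI B) :
    cxMk (eigProj A a b).1 (eigProj A a b).2 ∈ eigI B := by
  rw [cxMk_mem_eigI] at h ⊢
  simp only [eigProj, map_smul, map_sub, map_add, ← hAB, h.1, h.2, map_neg]
  constructor <;> module

theorem CSec.ext_eval {s t : CSec n R E} (h : ∀ x, s.eval x = t.eval x) : s = t := by
  have h' : ∀ x, s.1 x = t.1 x ∧ s.2 x = t.2 x := fun x => cxMk_inj.1 (h x)
  exact Prod.ext (ContMDiffSection.ext fun x => (h' x).1) (ContMDiffSection.ext fun x => (h' x).2)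

namespace IsSkewCubeField

variable {C : CourantAlgebroid n R E} {u : Sec n R E} {A B : ∀ x, Module.End ℝ (E x)}

theorem neg (hA : IsSkewCubeField C u A) : IsSkewCubeField C u (fun x => -A x) where
  smooth s := (-applyEnd hA.smooth s).contMDiff
  isSkewCube x := (hA.isSkewCube x).neg

theorem eigProjSec_mem (hA : IsSkewCubeField C u A) (s : CSec n R E) :
    IsSectionOf (fun x => eigI (A x)) (eigProjSec hA.smooth s) := fun x =>
  (hA.isSkewCube x).eigProj_mem _ _

/-- Any section through z, projected to the eigenbundle, still passes through z. Thus pointwise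
orthogonality to L can be tested on global sections of L. -/
theorem exists_section (hA : IsSkewCubeField C u A) (hval : ∀ x, CSec.values n R E x = ⊤) {x : M}
    {z : Cx (E x)} (hz : z ∈ eigI (A x)) :
    ∃ s : CSec n R E, IsSectionOf (fun x => eigI (A x)) s ∧ s.eval x = z := by
  obtain ⟨s, rfl⟩ : z ∈ CSec.values n R E x := by rw [hval]; trivial
  refine ⟨eigProjSec hA.smooth s, hA.eigProjSec_mem s, ?_⟩
  rw [eval_eigProjSec, eigProj_of_mem hz]
  rfl

theorem form_eq_zero (hA : IsSkewCubeField C u A) {s t : CSec n R E}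
    (hs : IsSectionOf (fun x => eigI (A x)) s) (ht : IsSectionOf (fun x => eigI (A x)) t) (x : M) :
    C.formC x (s.eval x) (t.eval x) = 0 :=
  (hA.isSkewCube x).form_eq_zero (hs x) (ht x)

theorem form_u_eq_zero (hA : IsSkewCubeField C u A) {s : CSec n R E}
    (hs : IsSectionOf (fun x => eigI (A x)) s) (x : M) :
    C.formC x ((realSec u).eval x) (s.eval x) = 0 :=
  (hA.isSkewCube x).form_u_eq_zero (hs x)

theorem form_u_eq_zero' (hA : IsSkewCubeField C u A) {s : CSec n R E}
    (hs : IsSectionOf (fun x => eigI (A x)) s) (x : M) :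
    C.formC x (s.eval x) ((realSec u).eval x) = 0 := by
  rw [C.formC_symm, hA.form_u_eq_zero hs]

/-- A section orthogonal to the `i`-eigenbundle and to the kernel is a section of the
`i`-eigenbundle. -/
theorem isSectionOf (hA : IsSkewCubeField C u A) (hval : ∀ x, CSec.values n R E x = ⊤)
    (hu : ∀ x, C.form x (u x) (u x) ≠ 0) {t : CSec n R E}
    (ht : ∀ s : CSec n R E, IsSectionOf (fun x => eigI (A x)) s → ∀ x, C.formC x (t.eval x) (s.eval x) = 0)
    (htu : ∀ x, C.formC x (t.eval x) ((realSec u).eval x) = 0) :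
    IsSectionOf (fun x => eigI (A x)) t := fun x =>
  (hA.isSkewCube x).mem_eigI (C.form_nondeg x) (hu x)
    (fun w hw => by
      obtain ⟨s, hs, rfl⟩ := hA.exists_section hval hw
      exact ht s hs x)
    (htu x)

theorem eq_add_eigProjSec (hA : IsSkewCubeField C u A)
    (hsq : ∀ x v, A x (A x v) = B x (B x v)) {s : CSec n R E}
    (hs : IsSectionOf (fun x => eigI (B x)) s) :
    s = eigProjSec hA.smooth s + eigProjSec hA.neg.smooth s := by
  refine CSec.ext_eval fun x => ?_
  have h := eigProj_add_neg (hsq x) (hs x)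
  rw [CSec.eval_add, eval_eigProjSec, eval_eigProjSec, cxMk_add]
  exact cxMk_inj.2 ⟨(congrArg Prod.fst h).symm, (congrArg Prod.snd h).symm⟩

theorem eigProjSec_mem_inf (hA : IsSkewCubeField C u A)
    (hAB : ∀ x v, A x (B x v) = B x (A x v)) {s : CSec n R E}
    (hs : IsSectionOf (fun x => eigI (B x)) s) :
    IsSectionOf (fun x => eigI (A x) ⊓ eigI (B x)) (eigProjSec hA.smooth s) := fun x =>
  ⟨hA.eigProjSec_mem s x, eigProj_mem_of_commute (hAB x) (hs x)⟩

/-- ⟨[u,v],u⟩ = -⟨v,[u,u]⟩, and [u,u] = 0 because ⟨u,u⟩ is constant. -/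
theorem form_bracketC_u (hA : IsSkewCubeField C u A) {c : ℝ}
    (hu : ∀ x, C.form x (u x) (u x) = c) {v : CSec n R E}
    (hv : IsSectionOf (fun x => eigI (A x)) v) (x : M) :
    C.formC x ((C.bracketC (realSec u) v).eval x) ((realSec u).eval x) = 0 := by
  have h0 : ∀ w : Sec n R E, C.form x (C.bracket u u x) (w x) = 0 := fun w => by
    have h := C.bracket_self u w x
    simp only [hu, dirDeriv_const] at h
    linarith
  have e : C.bracketC (realSec u) (realSec u) = realSec (C.bracket u u) := by
    rw [C.bracketC_realSec, realSec, map_zero]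
    rfl
  rw [C.formC_bracketC (hA.form_u_eq_zero' hv), e, C.formC_symm, C.formC_eval]
  simp only [realSec, h0, ContMDiffSection.coe_zero, Pi.zero_apply, map_zero,
    LinearMap.zero_apply]
  apply Complex.ext <;> simp

/-- If the `i`-eigenbundle of `A` is integrable, the Dorfman Lie derivative in the direction of the
kernel of `A` preserves it. -/
theorem liePreserves (hA : IsSkewCubeField C u A) (hval : ∀ x, CSec.values n R E x = ⊤) {c : ℝ}
    (hc : c ≠ 0) (hu : ∀ x, C.form x (u x) (u x) = c)
    (hint : C.IntegrableSub (fun x => eigI (A x))) :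
    C.LiePreserves u (fun x => eigI (A x)) := fun v hv => by
  rw [← C.bracketC_realSec]
  refine hA.isSectionOf hval (fun x => by rw [hu]; exact hc) (fun w hw x => ?_)
    (hA.form_bracketC_u hu hv)
  -- ⟨[u,v],w⟩ = -⟨[v,u],w⟩ = ⟨u,[v,w]⟩, and [v,w] lies in L, which is orthogonal to u.
  rw [C.formC_bracketC_swap (hA.form_u_eq_zero hv), C.formC_bracketC (hA.form_u_eq_zero hw),
    hA.form_u_eq_zero (hint v w hv hw), neg_zero, neg_zero]

/-- For commuting `A`, `B` with `A² = B²` and `A` integrable, if the Dorfman Lie derivative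
preserves the intersection of the `i`-eigenbundles of `A` and `B`, then it also preserves the
intersection of the `i`-eigenbundles of `A` and `-B`. -/
theorem liePreserves_inf_neg (hA : IsSkewCubeField C u A) (hB : IsSkewCubeField C u B)
    (hval : ∀ x, CSec.values n R E x = ⊤) {c : ℝ}
    (hc : c ≠ 0) (hu : ∀ x, C.form x (u x) (u x) = c)
    (hAB : ∀ x v, A x (B x v) = B x (A x v)) (hsq : ∀ x v, A x (A x v) = B x (B x v))
    (hint : C.IntegrableSub (fun x => eigI (A x)))
    (h : C.LiePreserves u (fun x => eigI (A x) ⊓ eigI (B x))) :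
    C.LiePreserves u (fun x => eigI (A x) ⊓ eigI (-B x)) := fun v hv => by
  have hvA : IsSectionOf (fun x => eigI (A x)) v := fun x => (hv x).1
  have hvB : IsSectionOf (fun x => eigI (-B x)) v := fun x => (hv x).2
  have htA := hA.liePreserves hval hc hu hint v hvA
  have hconj : C.LiePreserves u (fun x => eigI (-A x) ⊓ eigI (-B x)) := by
    have := C.liePreserves_conjSub h
    have e : (fun x => conjSub (eigI (A x) ⊓ eigI (B x)))
        = fun x => eigI (-A x) ⊓ eigI (-B x) := by
      funext x
      rw [← conjSub_eigI, ← conjSub_eigI]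
      rfl
    rwa [e] at this
  -- A test section w of the eigenbundle of -B splits along those of A and -A. The first part pairs
  -- to zero with [u,v] by isotropy for A. For the second part w₂, ⟨[u,v],w₂⟩ = -⟨v,[u,w₂]⟩ vanishes
  -- by isotropy for -B, since 𝐋_u preserves the conjugate intersection.
  have htB : IsSectionOf (fun x => eigI (-B x)) (C.bracket u v.1, C.bracket u v.2) := by
    rw [← C.bracketC_realSec] at htA ⊢
    refine hB.neg.isSectionOf hval (fun x => by rw [hu]; exact hc) (fun w hw x => ?_)
      (hA.form_bracketC_u hu hvA)
    have hw2 : IsSectionOf (fun x => eigI (-A x) ⊓ eigI (-B x)) (eigProjSec hA.neg.smooth w) :=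
      hA.neg.eigProjSec_mem_inf (B := fun x => -B x) (by simp [hAB]) hw
    have hw2' := hconj _ hw2
    rw [← C.bracketC_realSec] at hw2'
    rw [hA.eq_add_eigProjSec (B := fun x => -B x) (by simp [hsq]) hw, CSec.eval_add, map_add,
      hA.form_eq_zero htA (hA.eigProjSec_mem w), zero_add,
      C.formC_bracketC (hB.neg.form_eq_zero hvB fun y => (hw2 y).2),
      hB.neg.form_eq_zero hvB (fun y => (hw2' y).2), neg_zero]
  exact fun x => ⟨htA x, htB x⟩

/-- For commuting `A`, `B` with `A² = B²`, integrability of the intersections of the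
`i`-eigenbundles of `±A` and `B` together with the preservation of one of them by the Dorfman Lie
derivative implies integrability of the `i`-eigenbundle of `B`. -/
theorem integrableSub_of_inf (hA : IsSkewCubeField C u A) (hB : IsSkewCubeField C u B)
    (hval : ∀ x, CSec.values n R E x = ⊤) (hu : ∀ x, C.form x (u x) (u x) ≠ 0)
    (hAB : ∀ x v, A x (B x v) = B x (A x v)) (hsq : ∀ x v, A x (A x v) = B x (B x v))
    (hpos : C.IntegrableSub (fun x => eigI (A x) ⊓ eigI (B x)))
    (hneg : C.IntegrableSub (fun x => eigI (-A x) ⊓ eigI (B x)))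
    (h : C.LiePreserves u (fun x => eigI (A x) ⊓ eigI (B x))) :
    C.IntegrableSub (fun x => eigI (B x)) := by
  have hp : ∀ {s : CSec n R E}, IsSectionOf (fun x => eigI (B x)) s →
      IsSectionOf (fun x => eigI (A x) ⊓ eigI (B x)) (eigProjSec hA.smooth s) := fun hs =>
    hA.eigProjSec_mem_inf hAB hs
  have hm : ∀ {s : CSec n R E}, IsSectionOf (fun x => eigI (B x)) s →
      IsSectionOf (fun x => eigI (-A x) ⊓ eigI (B x)) (eigProjSec hA.neg.smooth s) := fun hs =>
    hA.neg.eigProjSec_mem_inf (by simp [hAB]) hs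
  have hmixed : ∀ v w : CSec n R E, IsSectionOf (fun x => eigI (A x) ⊓ eigI (B x)) v →
      IsSectionOf (fun x => eigI (-A x) ⊓ eigI (B x)) w →
      IsSectionOf (fun x => eigI (B x)) (C.bracketC v w)
        ∧ IsSectionOf (fun x => eigI (B x)) (C.bracketC w v) := by
    intro v w hv hw
    have hvB : IsSectionOf (fun x => eigI (B x)) v := fun x => (hv x).2
    have hwB : IsSectionOf (fun x => eigI (B x)) w := fun x => (hw x).2
    have hvw := hB.form_eq_zero hvB hwB
    have h1 : ∀ s : CSec n R E, IsSectionOf (fun x => eigI (B x)) s → ∀ x,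
        C.formC x ((C.bracketC v w).eval x) (s.eval x) = 0 := by
      intro s hs x
      have hs1 := hp hs
      have hs2 := hm hs
      -- With s = s₁ + s₂, ⟨[v,w],s₁⟩ = -⟨w,[v,s₁]⟩ uses closure of the summand of v, and ⟨[v,w],s₂⟩
      -- = ⟨v,[w,s₂]⟩ that of w. Both right-hand sides vanish by isotropy for B.
      rw [hA.eq_add_eigProjSec hsq hs, CSec.eval_add, map_add,
        C.formC_bracketC (hB.form_eq_zero hwB fun y => (hs1 y).2),
        hB.form_eq_zero hwB (fun y => (hpos v _ hv hs1 y).2),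
        C.formC_bracketC_swap hvw,
        C.formC_bracketC (hB.form_eq_zero hvB fun y => (hs2 y).2),
        hB.form_eq_zero hvB (fun y => (hneg w _ hw hs2 y).2)]
      simp
    have h2 : ∀ x, C.formC x ((C.bracketC v w).eval x) ((realSec u).eval x) = 0 := by
      intro x
      have hLv := h v hv
      rw [← C.bracketC_realSec] at hLv
      -- ⟨[v,w],u⟩ = -⟨w,[v,u]⟩ = ⟨w,[u,v]⟩: this is where preservation by 𝐋_u enters.
      rw [C.formC_bracketC (hB.form_u_eq_zero' hwB), C.formC_symm,
        C.formC_bracketC_swap (hB.form_u_eq_zero' hvB),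
        hB.form_eq_zero (fun y => (hLv y).2) hwB, neg_zero, neg_zero]
    refine ⟨hB.isSectionOf hval hu h1 h2, hB.isSectionOf hval hu (fun s hs x => ?_) fun x => ?_⟩
    · rw [C.formC_bracketC_swap (hB.form_eq_zero hwB hvB), h1 s hs, neg_zero]
    · rw [C.formC_bracketC_swap (hB.form_eq_zero hwB hvB), h2, neg_zero]
  intro s t hs ht x
  have e : C.bracketC s t
      = C.bracketC (eigProjSec hA.smooth s) (eigProjSec hA.smooth t)
        + C.bracketC (eigProjSec hA.smooth s) (eigProjSec hA.neg.smooth t)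
        + (C.bracketC (eigProjSec hA.neg.smooth s) (eigProjSec hA.smooth t)
        + C.bracketC (eigProjSec hA.neg.smooth s) (eigProjSec hA.neg.smooth t)) := by
    rw [← C.bracketC_add_right, ← C.bracketC_add_right, ← C.bracketC_add_left,
      ← hA.eq_add_eigProjSec hsq hs, ← hA.eq_add_eigProjSec hsq ht]
  rw [e, CSec.eval_add, CSec.eval_add, CSec.eval_add]
  exact add_mem (add_mem (hpos _ _ (hp hs) (hp ht) x).2 ((hmixed _ _ (hp hs) (hm ht)).1 x))
    (add_mem ((hmixed _ _ (hp ht) (hm hs)).2 x) (hneg _ _ (hm hs) (hm ht) x).2)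

end IsSkewCubeField

end SkewCubeFields

/-! ### The involution 𝒢^end: algebra and smoothness. -/

section GeneralizedMetric

variable {n : ℕ} {M : Type*} [TopologicalSpace M] [ChartedSpace (EuclideanSpace ℝ (Fin n)) M]
  [IsManifold (𝓡 n) ∞ M]
  {R : Type*} [NormedAddCommGroup R] [NormedSpace ℝ R] [FiniteDimensional ℝ R]
  {E : M → Type*} [TopologicalSpace (TotalSpace R E)] [∀ x, TopologicalSpace (E x)]
  [∀ x, AddCommGroup (E x)] [∀ x, Module ℝ (E x)] [FiberBundle R E] [VectorBundle ℝ R E]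
  [ContMDiffVectorBundle ∞ R E (𝓡 n)]

theorem contMDiffAt_det {k : ℕ} {g : M → Matrix (Fin k) (Fin k) ℝ} {x₀ : M}
    (hg : ∀ i j, ContMDiffAt (𝓡 n) 𝓘(ℝ, ℝ) ∞ (fun x => g x i j) x₀) :
    ContMDiffAt (𝓡 n) 𝓘(ℝ, ℝ) ∞ (fun x => (g x).det) x₀ := by
  simp only [Matrix.det_apply]
  refine ContMDiffAt.sum fun σ _ => ?_
  have h : ContMDiffAt (𝓡 n) 𝓘(ℝ, ℝ) ∞ (fun x => ∏ i, g x (σ i) i) x₀ :=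
    ContMDiffAt.prod fun i _ => hg _ _
  have hc : ContMDiffAt (𝓡 n) 𝓘(ℝ, ℝ) ∞ (fun _ : M => ((Equiv.Perm.sign σ : ℤ) : ℝ)) x₀ :=
    contMDiffAt_const
  refine (hc.mul h).congr_of_eventuallyEq (Filter.Eventually.of_forall fun x => ?_)
  simp [Units.smul_def]

/-- The Gram matrix of a basis of a non-degenerate subspace is invertible. -/
theorem det_gram_ne_zero {V : Type*} [AddCommGroup V] [Module ℝ V] {B : LinearMap.BilinForm ℝ V}
    {S : Submodule ℝ V} (hS : (B.restrict S).Nondegenerate) {k : ℕ} {e : Fin k → V}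
    (he : LinearIndependent ℝ e) (hspan : Submodule.span ℝ (Set.range e) = S) :
    (Matrix.of fun i j => B (e i) (e j)).det ≠ 0 := by
  intro h0
  obtain ⟨c, hc, hc0⟩ := Matrix.exists_vecMul_eq_zero_iff.2 h0
  have hmem : ∑ i, c i • e i ∈ S := by
    rw [← hspan]
    exact Submodule.sum_mem _ fun i _ =>
      Submodule.smul_mem _ _ (Submodule.subset_span ⟨i, rfl⟩)
  have hB : ∀ y ∈ S, B (∑ i, c i • e i) y = 0 := by
    intro y hy
    rw [← hspan] at hy
    induction hy using Submodule.span_induction with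
    | mem y hy =>
      obtain ⟨j, rfl⟩ := hy
      have := congrFun hc0 j
      simpa [Matrix.vecMul, dotProduct] using this
    | zero => simp
    | add y z _ _ hy hz => rw [map_add, hy, hz, add_zero]
    | smul a y _ hy => rw [map_smul, hy, smul_zero]
  have := hS.1 ⟨_, hmem⟩ fun y => hB y.1 y.2
  exact hc (funext (Fintype.linearIndependent_iff.1 he c (congrArg Subtype.val this)))

namespace CourantAlgebroid.GenMetric

variable {C : CourantAlgebroid n R E} (G : C.GenMetric)

/-- Expresses 𝒢^end through the E₋-component alone, so a local frame of E₋ suffices for smoothness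
and no frame of E₊ is needed. -/
theorem gend_apply {x : M} {s v : E x} (hv : v ∈ G.minus x) (hs : s - v ∈ G.plus x) :
    G.gend x s = s - (2 : ℝ) • v := by
  have e : s = (s - v) + v := by abel
  have h1 := (Submodule.projection_apply_eq_zero_iff (G.isCompl x)).2 hv
  have h2 := (Submodule.projection_apply_eq_zero_iff (G.isCompl x).symm).2 hs
  have h3 := Submodule.projection_apply_of_mem_left (G.isCompl x) hs
  have h4 := Submodule.projection_apply_of_mem_left (G.isCompl x).symm hv
  conv_lhs => rw [e]
  rw [gend, LinearMap.sub_apply, map_add, map_add, h1, h2, h3, h4]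
  module

theorem exists_decomp (x : M) (s : E x) : ∃ v ∈ G.minus x, s - v ∈ G.plus x := by
  have hs : s ∈ G.plus x ⊔ G.minus x := by rw [(G.isCompl x).sup_eq_top]; trivial
  obtain ⟨p, hp, v, hv, rfl⟩ := Submodule.mem_sup.1 hs
  exact ⟨v, hv, by rwa [add_sub_cancel_right]⟩

theorem gend_gend (x : M) (s : E x) : G.gend x (G.gend x s) = s := by
  obtain ⟨v, hv, hs⟩ := G.exists_decomp x s
  have e : s - (2 : ℝ) • v - -v = s - v := by module
  rw [G.gend_apply hv hs, G.gend_apply (v := -v) (neg_mem hv) (by rw [e]; exact hs)]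
  module

theorem form_plus_minus {x : M} {p v : E x} (hp : p ∈ G.plus x) (hv : v ∈ G.minus x) :
    C.form x p v = 0 := by
  rw [(C.form_symm x).eq]
  exact hp v hv

theorem form_gend (x : M) (s t : E x) : C.form x (G.gend x s) t = C.form x s (G.gend x t) := by
  obtain ⟨v, hv, hs⟩ := G.exists_decomp x s
  obtain ⟨w, hw, ht⟩ := G.exists_decomp x t
  have h1 := G.form_plus_minus hs hw
  have h2 := G.form_plus_minus ht hv
  rw [(C.form_symm x).eq] at h2
  rw [G.gend_apply hv hs, G.gend_apply hw ht]
  simp only [map_sub, map_smul, LinearMap.sub_apply, LinearMap.smul_apply, smul_eq_mul] at *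
  linarith

theorem smoothSection_gend (s : Sec n R E) : SmoothSection n R (fun x => G.gend x (s x)) := by
  intro x₀
  obtain ⟨e, he⟩ := G.subbundle x₀
  let g : M → Matrix (Fin n) (Fin n) ℝ := fun x =>
    Matrix.of fun i j => C.form x (e i x) (e j x)
  let b : M → Fin n → ℝ := fun x i => C.form x (e i x) (s x)
  have hdet : ∀ᶠ x in 𝓝 x₀, (g x).det ≠ 0 := he.mono fun x hx =>
    det_gram_ne_zero (G.nondeg x) hx.1 hx.2
  -- Cramer's rule for the Gram matrix of the frame: these are the coefficients of the orthogonal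
  -- projection of s to E₋, smooth near x₀ because the determinant does not vanish there.
  let c : Fin n → M → ℝ := fun j x => (g x).det⁻¹ * ((g x).updateCol j (b x)).det
  have hform := fun u v : Sec n R E => (C.form_smooth u v).contMDiffAt (x := x₀)
  have hc : ∀ j, ContMDiffAt (𝓡 n) 𝓘(ℝ, ℝ) ∞ (c j) x₀ := by
    intro j
    refine ((contMDiffAt_det fun i k => hform (e i) (e k)).inv₀ hdet.self_of_nhds).mul
      (contMDiffAt_det fun i k => ?_)
    by_cases hk : k = j
    · subst hk
      simpa [b] using hform (e i) s
    · simpa [Matrix.updateCol_ne hk, g] using hform (e i) (e k)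
  have hsm : ContMDiffAt (𝓡 n) ((𝓡 n).prod 𝓘(ℝ, R)) ∞ (fun x => TotalSpace.mk' R x
      (s x - (2 : ℝ) • ∑ j, c j x • e j x)) x₀ := by
    have h1 := ContMDiffAt.sum_section (t := fun j x => c j x • e j x) (s := Finset.univ)
      fun j _ => (hc j).smul_section (e j).contMDiff.contMDiffAt
    exact s.contMDiff.contMDiffAt.sub_section (h1.const_smul_section (a := (2 : ℝ)))
  refine hsm.congr_of_eventuallyEq ?_
  filter_upwards [he, hdet] with x hx hx0
  rw [G.gend_apply (v := ∑ j, c j x • e j x)]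
  · rw [← hx.2]
    exact Submodule.sum_mem _ fun i _ =>
      Submodule.smul_mem _ _ (Submodule.subset_span ⟨i, rfl⟩)
  · have hcr : ∀ k, ∑ j, c j x * C.form x (e k x) (e j x) = C.form x (e k x) (s x) := by
      intro k
      have h := congrFun (Matrix.mulVec_cramer (g x) (b x)) k
      simp only [Matrix.mulVec, dotProduct, Matrix.cramer_apply, Pi.smul_apply,
        smul_eq_mul] at h
      have : ∑ j, c j x * C.form x (e k x) (e j x)
          = (g x).det⁻¹ * ∑ j, g x k j * ((g x).updateCol j (b x)).det := by
        rw [Finset.mul_sum]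
        refine Finset.sum_congr rfl fun j _ => ?_
        simp only [c, g, Matrix.of_apply]
        ring
      rw [this, h, inv_mul_cancel_left₀ hx0]
    intro y hy
    change C.form x y _ = 0
    rw [← hx.2] at hy
    induction hy using Submodule.span_induction with
    | mem y hy =>
      obtain ⟨k, rfl⟩ := hy
      simp only [map_sub, map_sum, map_smul, smul_eq_mul, hcr, sub_self]
    | zero => simp
    | add y z _ _ hy hz => rw [map_add, LinearMap.add_apply, hy, hz, add_zero]
    | smul a y _ hy => rw [map_smul, LinearMap.smul_apply, hy, smul_zero]

end CourantAlgebroid.GenMetric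

end GeneralizedMetric

/-! ### Passing between almost complex structures and skew fields with A³ = -A. -/

section AlmostComplex

variable {n : ℕ} {M : Type*} [TopologicalSpace M] [ChartedSpace (EuclideanSpace ℝ (Fin n)) M]
  [IsManifold (𝓡 n) ∞ M]
  {R : Type*} [NormedAddCommGroup R] [NormedSpace ℝ R]
  {E : M → Type*} [TopologicalSpace (TotalSpace R E)] [∀ x, TopologicalSpace (E x)]
  [∀ x, AddCommGroup (E x)] [∀ x, Module ℝ (E x)] [FiberBundle R E] [VectorBundle ℝ R E]
  [ContMDiffVectorBundle ∞ R E (𝓡 n)]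

/-- The rank 2n+1 is what leaves exactly one dimension for the kernel of 𝓕 beside L₁ ⊕ L̄₁. -/
theorem CourantAlgebroid.IsOddExact.finrank_eq {C : CourantAlgebroid n R E} (hC : C.IsOddExact)
    (x : M) : Module.finrank ℝ (E x) = 2 * n + 1 := by
  obtain ⟨H, F, Φ, -⟩ := hC
  have h : Module.finrank ℝ (TangentSpace (𝓡 n) x) = n := by
    change Module.finrank ℝ (EuclideanSpace ℝ (Fin n)) = n
    simp
  have : Module.Finite ℝ (TangentSpace (𝓡 n) x) :=
    inferInstanceAs (Module.Finite ℝ (EuclideanSpace ℝ (Fin n)))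
  have : Module.Free ℝ (TangentSpace (𝓡 n) x) :=
    inferInstanceAs (Module.Free ℝ (EuclideanSpace ℝ (Fin n)))
  rw [(Φ x).finrank_eq, Module.finrank_prod, Module.finrank_prod, Subspace.dual_finrank_eq, h,
    Module.finrank_self]
  ring

theorem IsCxSubbundle.finrank_eq {k : ℕ} {S : ∀ x, Submodule ℂ (Cx (E x))}
    (h : IsCxSubbundle n R k S) (x : M) : Module.finrank ℂ (S x) = k := by
  obtain ⟨s, hs⟩ := h x
  obtain ⟨hli, hspan⟩ := hs.self_of_nhds
  rw [← hspan, finrank_span_eq_card hli, Fintype.card_fin]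

theorem IsCxSubbundle.le_values {k : ℕ} {S : ∀ x, Submodule ℂ (Cx (E x))}
    (h : IsCxSubbundle n R k S) (x : M) : S x ≤ CSec.values n R E x := by
  obtain ⟨s, hs⟩ := h x
  rw [← hs.self_of_nhds.2, Submodule.span_le]
  rintro _ ⟨i, rfl⟩
  exact CSec.eval_mem_values _ x

namespace CourantAlgebroid

variable {C : CourantAlgebroid n R E} {A : ∀ x, Module.End ℝ (E x)}

theorem IsAlmostComplex.isSkewCubeField [FiniteDimensional ℝ R] (hA : C.IsAlmostComplex A)
    (hrank : ∀ x, Module.finrank ℝ (E x) = 2 * n + 1) {u : Sec n R E}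
    (hu : ∀ x, u x ≠ 0) (hAu : ∀ x, A x (u x) = 0) : IsSkewCubeField C u A where
  smooth := hA.smooth
  isSkewCube x := by
    have : FiniteDimensional ℝ (E x) := VectorBundle.finiteDimensional ℝ R E x
    exact isSkewCube_of_eigI (C.form_symm x) (by rw [hA.subbundle.finrank_eq x, hrank])
      (hA.isotropic x) (hA.kernel x) (hu x) (hAu x)

/-- The eigenbundles and the kernel of an almost complex structure are spanned by values of global
sections, hence so is `E_ℂ`. -/
theorem IsAlmostComplex.values_eq_top (hA : C.IsAlmostComplex A) {u : Sec n R E}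
    (hA' : IsSkewCubeField C u A) (x : M) : CSec.values n R E x = ⊤ := by
  rw [eq_top_iff]
  intro z _
  obtain ⟨a, b, rfl⟩ := exists_eq_cxMk z
  obtain ⟨c, hc⟩ := (hA'.isSkewCube x).eq_add_eigProj a b
  have hle := hA.subbundle.le_values x
  rw [hc]
  refine add_mem (add_mem (hle ((hA'.isSkewCube x).eigProj_mem a b)) ?_)
    (Submodule.smul_mem _ _ (CSec.eval_mem_values (realSec u) x))
  have h := (hA'.isSkewCube x).neg.eigProj_mem a b
  rw [← conjSub_eigI] at h
  have := CSec.conj_mem_values (hle h)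
  rwa [cxConj_cxConj] at this

theorem continuous_formC (s t : CSec n R E) :
    Continuous (fun x => C.formC x (s.eval x) (t.eval x)) := by
  have hf := fun u v : Sec n R E => (C.form_smooth u v).continuous
  have e : (fun x => C.formC x (s.eval x) (t.eval x)) = fun x =>
      ((C.form x (s.1 x) (t.1 x) - C.form x (s.2 x) (t.2 x) : ℝ) : ℂ)
        + ((C.form x (s.1 x) (t.2 x) + C.form x (s.2 x) (t.1 x) : ℝ) : ℂ) * Complex.I := by
    funext x
    rw [C.formC_eval]
    apply Complex.ext <;> simp
  rw [e]
  exact (Complex.continuous_ofReal.comp ((hf _ _).sub (hf _ _))).add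
    ((Complex.continuous_ofReal.comp ((hf _ _).add (hf _ _))).mul continuous_const)

end CourantAlgebroid

namespace IsSkewCubeField

variable {C : CourantAlgebroid n R E} {A : ∀ x, Module.End ℝ (E x)} {u : Sec n R E}

/-- A basis of the fibre at x₀ extends to sections of the eigenbundle. They stay independent nearby
by continuity of a Gram determinant, and they span because the rank is n everywhere. -/
theorem isCxSubbundle [FiniteDimensional ℝ R] (hA : IsSkewCubeField C u A)
    (hval : ∀ x, CSec.values n R E x = ⊤) (hrank : ∀ x, Module.finrank ℝ (E x) = 2 * n + 1)
    (hu : ∀ x, C.form x (u x) (u x) ≠ 0) : IsCxSubbundle n R n (fun x => eigI (A x)) := by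
  have hfin : ∀ x, FiniteDimensional ℝ (E x) := fun x =>
    VectorBundle.finiteDimensional ℝ R E x
  have hL : ∀ x, Module.finrank ℂ (eigI (A x)) = n := fun x => by
    have h := (hA.isSkewCube x).finrank_eigI (fun h0 => hu x (by rw [h0]; simp))
    rw [hrank] at h
    omega
  intro x₀
  let b := Module.finBasisOfFinrankEq ℂ (eigI (A x₀)) (hL x₀)
  choose s hs hsb using fun i => hA.exists_section hval (b i).2
  -- Conjugation in the second slot is essential: the eigenbundle is isotropic, so the bilinear Gram
  -- matrix would be zero.
  let g : M → Matrix (Fin n) (Fin n) ℂ := fun x =>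
    Matrix.of fun i j => C.formC x ((s i).eval x) ((s j).conj.eval x)
  have hsum : ∀ (c : Fin n → ℂ) x j, Matrix.vecMul c (g x) j
      = C.formC x (∑ i, c i • (s i).eval x) ((s j).conj.eval x) := fun c x j => by
    simp [g, Matrix.vecMul, dotProduct]
  have hdet : (g x₀).det ≠ 0 := by
    intro h0
    obtain ⟨c, hc, hc0⟩ := Matrix.exists_vecMul_eq_zero_iff.2 h0
    set z := ∑ i, c i • (s i).eval x₀ with hz
    have hzmem : z ∈ eigI (A x₀) := Submodule.sum_mem _ fun i _ =>
      Submodule.smul_mem _ _ (hs i x₀)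
    have hz0 : ∀ j, C.formC x₀ z ((s j).conj.eval x₀) = 0 := fun j => by
      rw [← hsum, hc0, Pi.zero_apply]
    -- A null vector of the Gram matrix gives z in L orthogonal to L̄ and to u. The membership
    -- criterion for -A puts z in L̄ as well, hence z = 0.
    have hzneg : z ∈ eigI (-A x₀) := by
      refine (hA.isSkewCube x₀).neg.mem_eigI (C.form_nondeg x₀) (hu x₀) (fun w hw => ?_) ?_
      · rw [← conjSub_eigI] at hw
        have hw' : w = ∑ j, starRingEnd ℂ (b.repr ⟨cxConj w, hw⟩ j) • (s j).conj.eval x₀ := by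
          have h := congrArg (fun y => cxConj y.1) (b.sum_repr ⟨cxConj w, hw⟩)
          simp only [cxConj_cxConj] at h
          refine h.symm.trans ?_
          rw [Submodule.coe_sum, map_sum]
          exact Finset.sum_congr rfl fun j _ => by
            rw [Submodule.coe_smul, cxConj_smul, CSec.eval_conj, hsb]
        change C.formC x₀ z w = 0
        rw [hw', map_sum]
        exact Finset.sum_eq_zero fun j _ => by rw [map_smul, hz0, smul_zero]
      · change C.formC x₀ z _ = 0
        rw [C.formC_symm]
        exact (hA.isSkewCube x₀).form_u_eq_zero hzmem
    have hzz : z = 0 := Submodule.disjoint_def.1 (disjoint_eigI_neg (A x₀)) z hzmem hzneg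
    have hb : ∑ i, c i • b i = 0 := Subtype.ext (by
      rw [Submodule.coe_sum, ZeroMemClass.coe_zero, ← hzz, hz]
      exact Finset.sum_congr rfl fun i _ => by rw [Submodule.coe_smul, hsb])
    exact hc (funext (Fintype.linearIndependent_iff.1 b.linearIndependent c hb))
  have hcont : Continuous fun x => (g x).det :=
    Continuous.matrix_det (continuous_matrix fun i j => C.continuous_formC _ _)
  refine ⟨s, (hcont.continuousAt.eventually_ne hdet).mono fun x hx => ?_⟩
  have hli : LinearIndependent ℂ (fun i => (s i).eval x) := by
    rw [Fintype.linearIndependent_iff]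
    intro c hc
    have h0 : Matrix.vecMul c (g x) = 0 := funext fun j => by
      rw [hsum, hc]
      simp
    by_contra! hne
    obtain ⟨i, hi⟩ := hne
    exact hx (Matrix.exists_vecMul_eq_zero_iff.1 ⟨c, fun h => hi (congrFun h i), h0⟩)
  refine ⟨hli, Submodule.eq_of_le_of_finrank_eq ?_ ?_⟩
  · rw [Submodule.span_le]
    rintro _ ⟨i, rfl⟩
    exact hs i x
  · rw [finrank_span_eq_card hli, Fintype.card_fin, hL]

theorem isAlmostComplex [FiniteDimensional ℝ R] (hA : IsSkewCubeField C u A)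
    (hval : ∀ x, CSec.values n R E x = ⊤) (hrank : ∀ x, Module.finrank ℝ (E x) = 2 * n + 1)
    (hu : ∀ x, C.form x (u x) (u x) ≠ 0) : C.IsAlmostComplex A where
  smooth := hA.smooth
  subbundle := hA.isCxSubbundle hval hrank hu
  isotropic x v hv w hw := (hA.isSkewCube x).form_eq_zero hv hw
  disjoint x := by
    rw [conjSub_eigI]
    exact (disjoint_eigI_neg (A x)).eq_bot
  kernel x w hw := by
    obtain ⟨a, b, rfl⟩ := exists_eq_cxMk w
    -- Real parts of the pairings of w with the projections of y + iz to L and to L̄. Taking y = 0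
    -- or z = 0, the difference of the two relations isolates A a or A b.
    have h1 : ∀ y z, C.form x a (A x (A x y) - A x z) - C.form x b (A x (A x z) + A x y) = 0
        ∧ C.form x a (A x (A x y) + A x z) - C.form x b (A x (A x z) - A x y) = 0 := by
      intro y z
      have hp := hw _ (Submodule.mem_sup_left ((hA.isSkewCube x).eigProj_mem y z))
      have hm := hw _ (Submodule.mem_sup_right
        (by rw [conjSub_eigI]; exact (hA.isSkewCube x).neg.eigProj_mem y z))
      rw [CourantAlgebroid.formC, formBaseChange_cxMk] at hp hm
      have hp' := congrArg Complex.re hp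
      have hm' := congrArg Complex.re hm
      simp only [eigProj, map_smul, smul_eq_mul, LinearMap.neg_apply, map_neg, neg_neg,
        Complex.zero_re, map_sub, map_add] at hp' hm' ⊢
      constructor <;> linarith
    have hsk := (hA.isSkewCube x).skew
    have ha : A x a = 0 := (C.form_nondeg x).1 _ fun z => by
      have h := h1 0 z
      simp only [map_sub, map_add, map_zero] at h
      rw [hsk]
      linarith [h.1, h.2]
    have hb : A x b = 0 := (C.form_nondeg x).1 _ fun z => by
      have h := h1 z 0
      simp only [map_sub, map_add, map_zero] at h
      rw [hsk]
      linarith [h.1, h.2]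
    rw [baseChange_cxMk, ha, hb, cxMk_zero]

end IsSkewCubeField

end AlmostComplex

/-! ### The pair 𝓕, 𝓕₂ of a generalized almost pseudo-Hermitian structure. -/

section PseudoHermitian

variable {n : ℕ} {M : Type*} [TopologicalSpace M] [ChartedSpace (EuclideanSpace ℝ (Fin n)) M]
  [IsManifold (𝓡 n) ∞ M]
  {R : Type*} [NormedAddCommGroup R] [NormedSpace ℝ R] [FiniteDimensional ℝ R]
  {E : M → Type*} [TopologicalSpace (TotalSpace R E)] [∀ x, TopologicalSpace (E x)]
  [∀ x, AddCommGroup (E x)] [∀ x, Module ℝ (E x)] [FiberBundle R E] [VectorBundle ℝ R E]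
  [ContMDiffVectorBundle ∞ R E (𝓡 n)]

namespace CourantAlgebroid.AlmostPseudoHermitian

variable {C : CourantAlgebroid n R E} (P : C.AlmostPseudoHermitian)

theorem gend_F (x : M) (v : E x) : P.metric.gend x (P.F x v) = P.F x (P.metric.gend x v) :=
  LinearMap.congr_fun (P.comm x) v

theorem F₂_apply (x : M) (v : E x) : P.F₂ x v = P.metric.gend x (P.F x v) := rfl

theorem F_F₂ (x : M) (v : E x) : P.F x (P.F₂ x v) = P.F₂ x (P.F x v) := by
  rw [F₂_apply, F₂_apply, ← gend_F]

theorem F_F (x : M) (v : E x) : P.F x (P.F x v) = P.F₂ x (P.F₂ x v) := by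
  rw [F₂_apply, F₂_apply, ← gend_F, GenMetric.gend_gend]

theorem isSkewCubeField_F₂ {u : Sec n R E} (hF : IsSkewCubeField C u P.F) :
    IsSkewCubeField C u P.F₂ where
  smooth s := P.metric.smoothSection_gend (applyEnd hF.smooth s)
  isSkewCube x :=
    { skew := fun v w => by
        rw [F₂_apply, F₂_apply, P.metric.form_gend, (hF.isSkewCube x).skew, gend_F]
      cube := fun v => by
        rw [← F_F, F₂_apply, gend_F, (hF.isSkewCube x).cube]
      map_u := by rw [F₂_apply, (hF.isSkewCube x).map_u, map_zero]
      ker := fun v hv => (hF.isSkewCube x).ker v (by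
        rw [← P.metric.gend_gend x (P.F x v), ← F₂_apply, hv, map_zero]) }

theorem L₁minus_eq : P.L₁minus = fun x => eigI (P.F x) ⊓ eigI (-P.F₂ x) := by
  funext x
  rw [← conjSub_eigI]
  rfl

/-- Identifies the conjugate of L₁⁻ as the complement of L₁⁺ in L₂. -/
theorem conjSub_L₁minus :
    (fun x => conjSub (P.L₁minus x)) = fun x => eigI (-P.F x) ⊓ eigI (P.F₂ x) := by
  funext x
  rw [L₁minus_eq, ← conjSub_eigI (P.F x)]
  conv_rhs => rw [← neg_neg (P.F₂ x), ← conjSub_eigI (-P.F₂ x)]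
  rfl

end CourantAlgebroid.AlmostPseudoHermitian

end PseudoHermitian

end BnGeometry

end

/-! ### The main theorem. -/

theorem mainTheorem4 {n : ℕ} {M : Type*} [TopologicalSpace M] [T2Space M] [SigmaCompactSpace M]
    [ChartedSpace (EuclideanSpace ℝ (Fin n)) M] [IsManifold (𝓡 n) ∞ M]
    {R : Type*} [NormedAddCommGroup R] [NormedSpace ℝ R] [FiniteDimensional ℝ R]
    {E : M → Type*} [TopologicalSpace (TotalSpace R E)] [∀ x, TopologicalSpace (E x)]
    [∀ x, AddCommGroup (E x)] [∀ x, Module ℝ (E x)] [FiberBundle R E] [VectorBundle ℝ R E]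
    [ContMDiffVectorBundle ∞ R E (𝓡 n)]
    (C : BnGeometry.CourantAlgebroid n R E) (hC : C.IsOddExact)
    (P : C.AlmostPseudoHermitian)
    (u₀ : BnGeometry.Sec n R E) (hu₀ : P.IsNormalizedKernelSection u₀) :
    (C.IntegrableSub P.L₁ → (C.LiePreserves u₀ P.L₁plus ↔ C.LiePreserves u₀ P.L₁minus))
    ∧ (P.IsIntegrable ↔
        C.IntegrableSub P.L₁ ∧ C.IntegrableSub P.L₁plus ∧ C.IntegrableSub P.L₁minus
          ∧ C.LiePreserves u₀ P.L₁plus)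
    ∧ (P.IsIntegrable ↔
        C.IntegrableSub P.L₁ ∧ C.IntegrableSub P.L₁plus ∧ C.IntegrableSub P.L₁minus
          ∧ C.LiePreserves u₀ P.L₁minus) := by
  have hrank := hC.finrank_eq
  have hc : ((-1 : ℝ) ^ n) ≠ 0 := pow_ne_zero _ (by norm_num)
  have huc : ∀ x, C.form x (u₀ x) (u₀ x) = (-1) ^ n := fun x => (hu₀ x).2
  have hu : ∀ x, C.form x (u₀ x) (u₀ x) ≠ 0 := fun x => by rw [huc]; exact hc
  have hF := P.almostComplex.isSkewCubeField hrank
    (fun x h0 => hu x (by rw [h0]; simp)) fun x => (hu₀ x).1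
  have hF₂ := P.isSkewCubeField_F₂ hF
  have hval := P.almostComplex.values_eq_top hF
  have part1 : C.IntegrableSub P.L₁ →
      (C.LiePreserves u₀ P.L₁plus ↔ C.LiePreserves u₀ P.L₁minus) := by
    intro hint
    rw [P.L₁minus_eq]
    refine ⟨fun h => hF.liePreserves_inf_neg hF₂ hval hc huc P.F_F₂ P.F_F hint h, fun h => ?_⟩
    -- The converse is the same implication with -𝓕₂ in place of 𝓕₂, which exchanges L₁⁺ and L₁⁻.
    have h' := hF.liePreserves_inf_neg hF₂.neg hval hc huc (by simp [P.F_F₂]) (by simp [P.F_F])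
      hint h
    simp only [neg_neg] at h'
    exact h'
  have part2 : P.IsIntegrable ↔
      C.IntegrableSub P.L₁ ∧ C.IntegrableSub P.L₁plus ∧ C.IntegrableSub P.L₁minus
        ∧ C.LiePreserves u₀ P.L₁plus := by
    constructor
    · rintro ⟨⟨-, h1⟩, -, h2⟩
      exact ⟨h1, BnGeometry.CourantAlgebroid.IntegrableSub.inf C h1 h2,
        BnGeometry.CourantAlgebroid.IntegrableSub.inf C h1 (C.integrableSub_conjSub h2),
        BnGeometry.CourantAlgebroid.LiePreserves.inf C (hF.liePreserves hval hc huc h1)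
          (hF₂.liePreserves hval hc huc h2)⟩
    · rintro ⟨h1, hplus, hminus, hlie⟩
      have hneg := C.integrableSub_conjSub hminus
      rw [P.conjSub_L₁minus] at hneg
      exact ⟨⟨P.almostComplex, h1⟩, hF₂.isAlmostComplex hval hrank hu,
        hF.integrableSub_of_inf hF₂ hval hu P.F_F₂ P.F_F hplus hneg hlie⟩
  refine ⟨part1, part2, part2.trans ?_⟩
  exact and_congr_right fun h1 => and_congr_right fun _ => and_congr_right fun _ => part1 h1
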